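/- Let $\mathbb K$ be a commutative ring and let $B$ be a finite set with an involution $b\mapsto b^*$ (that is, $b^{**}=b$). **The bialgebra.** For $n\ge 0$ put $B\wr\mathfrak S_n=B^n\times\mathfrak S_n$, with $\pi\cdot(b_1,\dots,b_n;\sigma)=(b_{\pi^{-1}(1)},\dots,b_{\pi^{-1}(n)};\pi\sigma)$ for $\pi\in\mathfrak S_n$. Let $\mathscr F_n(\mathbb KB)$ be the free $\mathbb K$-module with basis $B\wr\mathfrak S_n$, and let $\mathscr F(\mathbb KB)=\bigoplus_{n\ge0}\mathscr F_n(\mathbb KB)$ be the free quasisymmetric graded bialgebra, with product $$(b_1,\dots,b_n;\sigma)*(b'_1,\dots,b'_m;\sigma')=\sum_\rho\rho\cdot(b_1,\dots,b_n,b'_1,\dots,b'_m;\sigma\times\sigma'),$$ where $\rho$ runs over the permutations in $\mathfrak S_{n+m}$ that are increasing on $[1,n]$ and on $[n+1,n+m]$, and with coproduct $$\Delta(b_1,\dots,b_n;\sigma)=\sum_{k=0}^n(b_1,\dots,b_k;\pi_k)\otimes(b_{k+1},\dots,b_n;\pi'_{n-k}),$$ where $\pi_k$ and $\pi'_{n-k}$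 are the inverses of the standardizations of the words $\sigma^{-1}(1)\cdots\sigma^{-1}(k)$ and $\sigma^{-1}(k+1)\cdots\sigma^{-1}(n)$. The unit is the element of $B\wr\mathfrak S_0$, and the counit is the projection onto $\mathscr F_0(\mathbb KB)=\mathbb K$. Let $\varpi_{\mathrm{tot}}$ be the symmetric bilinear form on $\mathscr F(\mathbb KB)$ such that, for basis elements $\alpha,\beta$, $\varpi_{\mathrm{tot}}(\alpha,\beta)=1$ if $\beta=\alpha^*$ and $0$ otherwise, where $(b_1,\dots,b_n;\sigma)^*=\sigma^{-1}\cdot(b_1^*,\dots,b_n^*;e_n)$. The polar of a submodule $S$ is $S^\circ=\{x\mid\varpi_{\mathrm{tot}}(x,y)=0\text{ for all }y\in S\}$. **Tableaux.** A $B$-tableau is a family $\mathbf T=(T_b)_{b\in B}$ of semistandard tableaux with integer labels; its shape $\mathrm{sh}(\mathbf T)$ is the family of the shapes of the $T_b$. It is standard if the labels $1,2,\dots,n$ are used exactly once each and no other label occurs, where $n$ is the total number of boxes. Write $\alpha\in B\wr\mathfrak S_n$ as $\alpha=\sigma\cdot(b_1,\dots,b_n;e_n)$ and put $w(\alpha)=(\sigma(1),b_1)\cdots(\sigma(n),b_n)$.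 The Robinson–Schensted–Okada (RSO) record tableau $\mathbf Q(\alpha)=(Q_b)_{b\in B}$ is obtained as follows: for each $b$, the letters $\sigma(j)$ with $b_j=b$ are inserted in increasing order of $j$ by Schensted row insertion, and $Q_b$ records with the label $j$ the box created when $\sigma(j)$ is inserted. For a standard $B$-tableau $\mathbf T$ with $n$ boxes, put $$t_{\mathbf T}=\sum_{\alpha\in B\wr\mathfrak S_n,\ \mathbf Q(\alpha)=\mathbf T}\alpha ,$$ and let $\mathscr Q(B)$ be the $\mathbb K$-submodule of $\mathscr F(\mathbb KB)$ spanned by the $t_{\mathbf T}$, for all standard $B$-tableaux $\mathbf T$. **Knuth relation.** For $\alpha,\alpha'\in B\wr\mathfrak S_n$ write $\alpha\sim_K\alpha'$ if $w(\alpha')$ is obtained from $w(\alpha)$ either by exchanging two consecutive letters with different second components, or by replacing three consecutive letters with the same second component $b$ and first components $u$ by letters with second component $b$ and first components $u'$, where $\{u,u'\}=\{xzy,zxy\}$ with $x\le y<z$, or $\{u,u'\}=\{yxz,yzx\}$ with $x<y\le z$. **Proposition.** 1. For each $n\ge0$, the module $\mathscr Q(B)^\circ\cap\mathscr F_n(\mathbb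 KB)$ is spanned over $\mathbb K$ by the differences $\alpha-\alpha'$, where $\alpha,\alpha'\in B\wr\mathfrak S_n$ and $\alpha\sim_K\alpha'$. 2. The submodule $\mathscr Q(B)$ is a graded subbialgebra of $(\mathscr F(\mathbb KB),*,\Delta)$: it is graded, contains the unit, is closed under $*$, and $\Delta(\mathscr Q(B))\subseteq\mathscr Q(B)\otimes\mathscr Q(B)$. The submodule $\mathscr Q(B)^\circ$ is a graded biideal: it is graded, is a two-sided ideal for $*$, satisfies $\Delta(\mathscr Q(B)^\circ)\subseteq\mathscr Q(B)^\circ\otimes\mathscr F(\mathbb KB)+\mathscr F(\mathbb KB)\otimes\mathscr Q(B)^\circ$, and the counit vanishes on it. 3. The submodule $\mathscr Q(B)\cap\mathscr Q(B)^\circ$ is spanned over $\mathbb K$ by the differences $t_{\mathbf T}-t_{\mathbf T'}$, where $\mathbf T$ and $\mathbf T'$ are standard $B$-tableaux with $\mathrm{sh}(\mathbf T)=\mathrm{sh}(\mathbf T')$. 4. The submodule $\mathscr Q(B)+\mathscr Q(B)^\circ$ is a direct summand of $\mathscr F(\mathbb KB)$. -/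

import Mathlib

open scoped TensorProduct

namespace FQ

/-! ### The free quasisymmetric bialgebra on a finite basis `B` -/

/-- The set `B ≀ 𝔖ₙ`: the pair `(c, σ)` stands for the element `(c₁, …, cₙ; σ)`, that is, for
`(c₁ ⊗ ⋯ ⊗ cₙ) # σ`. Positions and values are numbered from `0`. -/
abbrev Wr (B : Type*) (n : ℕ) : Type _ := (Fin n → B) × Equiv.Perm (Fin n)

/-- The left action `π · (c; σ) = (c ∘ π⁻¹; π σ)` of the symmetric group. -/
def leftAct {B : Type*} {n : ℕ} (π : Equiv.Perm (Fin n)) (α : Wr B n) : Wr B n :=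
  (fun i => α.1 (π⁻¹ i), π * α.2)

/-- The free module `𝓕(KB) = ⨁ₙ 𝓕ₙ(KB)`, with basis the disjoint union of the sets `B ≀ 𝔖ₙ`. -/
abbrev Free (K : Type*) [CommRing K] (B : Type*) : Type _ := (Σ n : ℕ, Wr B n) →₀ K

/-- The basis element of `𝓕(KB)` attached to `α ∈ B ≀ 𝔖ₙ`. -/
noncomputable def elt (K : Type*) [CommRing K] {B : Type*} {n : ℕ} (α : Wr B n) : Free K B :=
  Finsupp.single ⟨n, α⟩ 1

/-- The homogeneous component `𝓕ₙ(KB)`. -/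
def degreePart (K : Type*) [CommRing K] (B : Type*) (n : ℕ) : Submodule K (Free K B) :=
  Finsupp.supported K K {α | α.1 = n}

/-- The set `X_{(n,m)}` of the permutations that are increasing on the first `n` and on the last `m`
elements. -/
def shuffles (n m : ℕ) : Finset (Equiv.Perm (Fin (n + m))) :=
  {ρ | (∀ i j : Fin n, i < j → ρ (Fin.castAdd m i) < ρ (Fin.castAdd m j)) ∧
    (∀ i j : Fin m, i < j → ρ (Fin.natAdd n i) < ρ (Fin.natAdd n j))}

/-- The permutation `σ × σ'` of `n + m` elements. -/
def permProd {n m : ℕ} (σ : Equiv.Perm (Fin n)) (σ' : Equiv.Perm (Fin m)) :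
    Equiv.Perm (Fin (n + m)) :=
  finSumFinEquiv.permCongr (Equiv.Perm.sumCongr σ σ')

/-- The element `(c₁, …, cₙ, c'₁, …, c'ₘ; σ × σ')` of `B ≀ 𝔖ₙ₊ₘ`. -/
def concat {B : Type*} {n m : ℕ} (α : Wr B n) (β : Wr B m) : Wr B (n + m) :=
  (Fin.append α.1 β.1, permProd α.2 β.2)

/-- The external product: `α * β = ∑_{ρ ∈ X_{(n,m)}} ρ · (c, c'; σ × σ')`, extended bilinearly. -/
noncomputable def extMul (K : Type*) [CommRing K] (B : Type*) :
    Free K B →ₗ[K] Free K B →ₗ[K] Free K B :=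
  Finsupp.linearCombination K fun α =>
    Finsupp.linearCombination K fun β =>
      ∑ ρ ∈ shuffles α.1 β.1, elt K (leftAct ρ (concat α.2 β.2))

/-- The unit of the external product, the only element of `B ≀ 𝔖₀`. -/
noncomputable def one (K : Type*) [CommRing K] (B : Type*) : Free K B :=
  elt K ((Fin.elim0, 1) : Wr B 0)

/-- The standardization of a word. The permutation `Tuple.sort w` lists the positions of the letters
of `w` in weakly increasing order of letters, equal letters being listed from left to right; the
standardization is its inverse. -/
def standardization {A : Type*} [LinearOrder A] {n : ℕ} (w : Fin n → A) : Equiv.Perm (Fin n) :=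
  (Tuple.sort w)⁻¹

/-- `(c₁, …, c_k; π)`, where `π` is the inverse of the standardization of `σ⁻¹(1) ⋯ σ⁻¹(k)`. -/
def headPart {B : Type*} {n : ℕ} (α : Wr B n) (k : Fin (n + 1)) : Wr B (k : ℕ) :=
  (fun i => α.1 ⟨i, by omega⟩,
    (standardization fun i : Fin (k : ℕ) => α.2⁻¹ ⟨i, by omega⟩)⁻¹)

/-- `(c_{k+1}, …, cₙ; π')`, where `π'` is the inverse of the standardization of
`σ⁻¹(k+1) ⋯ σ⁻¹(n)`. -/
def tailPart {B : Type*} {n : ℕ} (α : Wr B n) (k : Fin (n + 1)) : Wr B (n - k) :=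
  (fun i => α.1 ⟨k + i, by omega⟩,
    (standardization fun i : Fin (n - k) => α.2⁻¹ ⟨k + i, by omega⟩)⁻¹)

/-- The coproduct. -/
noncomputable def comul (K : Type*) [CommRing K] (B : Type*) :
    Free K B →ₗ[K] Free K B ⊗[K] Free K B :=
  Finsupp.linearCombination K fun α =>
    ∑ k : Fin (α.1 + 1), elt K (headPart α.2 k) ⊗ₜ[K] elt K (tailPart α.2 k)

/-- The counit: the projection onto `𝓕₀(KB) = K`. -/
noncomputable def counit (K : Type*) [CommRing K] (B : Type*) : Free K B →ₗ[K] K :=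
  Finsupp.lapply ⟨0, (Fin.elim0, 1)⟩

/-- A submodule is graded if it is the sum of its homogeneous components. -/
def IsGraded {K : Type*} [CommRing K] {B : Type*} (S : Submodule K (Free K B)) : Prop :=
  S = ⨆ n, S ⊓ degreePart K B n

/-- Graded subbialgebras of `(𝓕(KB), *, Δ)`: graded submodules `S` that contain the unit, are closed
under the product, and satisfy `Δ(S) ⊆ S ⊗ S` (image in `𝓕(KB) ⊗ 𝓕(KB)`). -/
structure IsGradedSubbialgebra {K : Type*} [CommRing K] {B : Type*}
    (S : Submodule K (Free K B)) : Prop where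
  graded : IsGraded S
  one_mem : one K B ∈ S
  mul_mem : ∀ x ∈ S, ∀ y ∈ S, extMul K B x y ∈ S
  comul_mem : ∀ x ∈ S, comul K B x ∈ LinearMap.range (TensorProduct.map S.subtype S.subtype)

/-- Graded biideals of `(𝓕(KB), *, Δ)`: graded submodules `I` that are two-sided ideals for the
product, satisfy `Δ(I) ⊆ I ⊗ 𝓕(KB) + 𝓕(KB) ⊗ I`, and on which the counit vanishes. -/
structure IsGradedBiideal {K : Type*} [CommRing K] {B : Type*}
    (I : Submodule K (Free K B)) : Prop where
  graded : IsGraded I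
  mul_mem_left : ∀ x, ∀ y ∈ I, extMul K B x y ∈ I
  mul_mem_right : ∀ x ∈ I, ∀ y, extMul K B x y ∈ I
  comul_mem : ∀ x ∈ I, comul K B x ∈
    LinearMap.range (TensorProduct.map I.subtype (LinearMap.id : Free K B →ₗ[K] Free K B)) ⊔
    LinearMap.range (TensorProduct.map (LinearMap.id : Free K B →ₗ[K] Free K B) I.subtype)
  counit_eq_zero : ∀ x ∈ I, counit K B x = 0

/-! ### The pairing and polars -/

/-- The dual `α* = σ⁻¹ · (c₁*, …, cₙ*; e)` of `α = (c₁, …, cₙ; σ)`. -/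
def dual {B : Type*} (inv : B → B) {n : ℕ} (α : Wr B n) : Wr B n :=
  leftAct α.2⁻¹ (fun i => inv (α.1 i), 1)

/-- The pairing on `𝓕(KB)` induced by the pairing `ϖ` of `KB` with `ϖ(b, b') = 1` if `b' = b*` and
`0` otherwise: components of different degrees are orthogonal, and the pairing of `(c; σ)` with
`(c'; σ')` is `∏ᵢ ϖ(c_{σ(i)}, c'ᵢ)` if `σ' = σ⁻¹` and `0` otherwise; in other words it is `1` if
`(c'; σ')` is the dual of `(c; σ)`, and `0` otherwise. -/
noncomputable def pairing (K : Type*) [CommRing K] {B : Type*} (inv : B → B) :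
    Free K B →ₗ[K] Free K B →ₗ[K] K :=
  Finsupp.linearCombination K fun α => Finsupp.lapply ⟨α.1, dual inv α.2⟩

/-- The polar of a submodule with respect to the pairing. -/
def polar {K : Type*} [CommRing K] {B : Type*} (inv : B → B) (S : Submodule K (Free K B)) :
    Submodule K (Free K B) where
  carrier := {x | ∀ y ∈ S, pairing K inv x y = 0}
  zero_mem' := fun y _ => by simp
  add_mem' := fun hx hx' y hy => by simp [hx y hy, hx' y hy]
  smul_mem' := fun a x hx y hy => by simp [hx y hy]

/-! ### Words and Knuth relations -/

/-- The word `w(α) = (σ(1), b₁) ⋯ (σ(n), bₙ)`, where `α = σ · (b₁, …, bₙ; e)`, that is,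
`bᵢ = c_{σ(i)}`. -/
def word {B : Type*} {n : ℕ} (α : Wr B n) : List (ℕ × B) :=
  List.ofFn fun i : Fin n => ((α.2 i : ℕ) + 1, α.1 (α.2 i))

/-- The Knuth relation on words with letters in `ℕ × B`: either exchange two consecutive letters
with different second components, or apply one of the usual relations `acb ∼ cab` for `a ≤ b < c` and
`bac ∼ bca` for `a < b ≤ c` to three consecutive letters with the same second component. -/
inductive Knuth {B : Type*} : List (ℕ × B) → List (ℕ × B) → Prop
  | exchange (u v : List (ℕ × B)) (x y : ℕ × B) (h : x.2 ≠ y.2) :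
      Knuth (u ++ [x, y] ++ v) (u ++ [y, x] ++ v)
  | acb_cab (u v : List (ℕ × B)) (a b c : ℕ) (β : B) (hab : a ≤ b) (hbc : b < c) :
      Knuth (u ++ [(a, β), (c, β), (b, β)] ++ v) (u ++ [(c, β), (a, β), (b, β)] ++ v)
  | cab_acb (u v : List (ℕ × B)) (a b c : ℕ) (β : B) (hab : a ≤ b) (hbc : b < c) :
      Knuth (u ++ [(c, β), (a, β), (b, β)] ++ v) (u ++ [(a, β), (c, β), (b, β)] ++ v)
  | bac_bca (u v : List (ℕ × B)) (a b c : ℕ) (β : B) (hab : a < b) (hbc : b ≤ c) :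
      Knuth (u ++ [(b, β), (a, β), (c, β)] ++ v) (u ++ [(b, β), (c, β), (a, β)] ++ v)
  | bca_bac (u v : List (ℕ × B)) (a b c : ℕ) (β : B) (hab : a < b) (hbc : b ≤ c) :
      Knuth (u ++ [(b, β), (c, β), (a, β)] ++ v) (u ++ [(b, β), (a, β), (c, β)] ++ v)

/-! ### The Robinson-Schensted-Okada correspondence -/

/-- Row insertion of the letter `a`: it replaces the first entry that is greater than `a`, and this
entry is bumped; if there is no such entry, then `a` is put at the end of the row. -/
def rowInsert (a : ℕ) : List ℕ → List ℕ × Option ℕ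
  | [] => ([a], none)
  | x :: r => if a < x then (a :: r, some x) else (x :: (rowInsert a r).1, (rowInsert a r).2)

/-- A step of the Robinson-Schensted correspondence. A pair `(P, Q)` of tableaux of the same shape is
given as the list of the pairs (row of `P`, row of `Q`). The letter `a` is inserted in `P` by bumping
from row to row, and the label `j` is put in the new box of `Q`. -/
def insertStep (j : ℕ) : ℕ → List (List ℕ × List ℕ) → List (List ℕ × List ℕ)
  | a, [] => [([a], [j])]
  | a, (p, q) :: t =>
    match rowInsert a p with
    | (p', none) => (p', q ++ [j]) :: t
    | (p', some c) => (p', q) :: insertStep j c t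

/-- The pair `(P, Q)` attached to a word in two lines, a list of pairs (label, letter). -/
def robinsonSchensted (w : List (ℕ × ℕ)) : List (List ℕ × List ℕ) :=
  w.foldl (fun t x => insertStep x.1 x.2 t) []

/-- The component of index `b` of the RSO correspondent of `α`: the subword of `w(α)` formed by the
letters of colour `b` is inserted, the labels being the positions (from `1` to `n`) of these letters
in `w(α)`. -/
def rso {B : Type*} [DecidableEq B] {n : ℕ} (α : Wr B n) (b : B) : List (List ℕ × List ℕ) :=
  robinsonSchensted
    (((List.finRange n).filter fun i : Fin n => α.1 (α.2 i) = b).map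
      fun i : Fin n => ((i : ℕ) + 1, (α.2 i : ℕ) + 1))

/-- The rows of the component of index `b` of the insertion tableau `𝐏(α)`. -/
def insertionRows {B : Type*} [DecidableEq B] {n : ℕ} (α : Wr B n) (b : B) : List (List ℕ) :=
  (rso α b).map Prod.fst

/-- The rows of the component of index `b` of the record tableau `𝐐(α)`. -/
def recordRows {B : Type*} [DecidableEq B] {n : ℕ} (α : Wr B n) (b : B) : List (List ℕ) :=
  (rso α b).map Prod.snd

/-! ### Tableaux -/

/-- A semistandard tableau with its shape. -/
abbrev Tableau : Type := Σ μ : YoungDiagram, SemistandardYoungTableau μ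

/-- The list of the rows of a tableau. -/
def Tableau.rows (T : Tableau) : List (List ℕ) :=
  (List.range (T.1.colLen 0)).map fun i => (List.range (T.1.rowLen i)).map fun j => T.2 i j

/-- The weight of a tableau: the multiset of its labels. -/
def Tableau.weight (T : Tableau) : Multiset ℕ :=
  T.1.cells.val.map fun c => T.2 c.1 c.2

/-- A `B`-tableau is a family of tableaux indexed by `B`. -/
abbrev BTableau (B : Type*) : Type _ := B → Tableau

/-- The shape of a `B`-tableau. -/
def BTableau.shape {B : Type*} (T : BTableau B) : B → YoungDiagram := fun b => (T b).1

/-- The total number of boxes of a `B`-tableau. -/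
def BTableau.size {B : Type*} [Fintype B] (T : BTableau B) : ℕ := ∑ b, (T.shape b).card

/-- A `B`-tableau with `n` boxes is standard if each of the labels `1, …, n` is used exactly once. -/
def BTableau.IsStandard {B : Type*} [Fintype B] (T : BTableau B) : Prop :=
  ∑ b, (T b).weight = (Finset.Icc 1 T.size).val

/-! ### Coplactic classes -/

/-- The coplactic class `t_𝐓`: the sum of the elements `α` of `B ≀ 𝔖ₙ` with `𝐐(α) = 𝐓`, where `n` is
the number of boxes of `𝐓`. -/
noncomputable def coplacticClass (K : Type*) [CommRing K] {B : Type*} [Fintype B] [DecidableEq B]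
    (T : BTableau B) : Free K B :=
  ∑ α : Wr B T.size with ∀ b, recordRows α b = (T b).rows, elt K α

/-- The submodule `𝓠(B)` spanned by the coplactic classes of the standard `B`-tableaux. -/
noncomputable def coplactic (K : Type*) [CommRing K] (B : Type*) [Fintype B] [DecidableEq B] :
    Submodule K (Free K B) :=
  Submodule.span K {x | ∃ T : BTableau B, T.IsStandard ∧ x = coplacticClass K T}

end FQ

/-!
For the pairing `ϖ`, the submodule `𝓠(B)` is spanned by the sums over the fibers of the record
tableau `𝐐`. Schützenberger's symmetry says that `α ↦ α*` exchanges the insertion tableau `𝐏(α)` and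
the record tableau `𝐐(α)`, up to the involution of `B`; hence `𝓠(B)°` is the kernel of the linear
map induced by `α ↦ 𝐏(α)`, and Knuth's theorem provides generators of this kernel. A Knuth relation
is preserved by shuffles of values and by restriction to intervals of values, so `𝓠(B)°` is a
biideal. The product and the coproduct are adjoint to each other for `ϖ`, and `𝓠(B)` is its own
double polar, so `𝓠(B)` is a subbialgebra. The last two assertions are linear algebra: the
Robinson-Schensted-Okada correspondence identifies the basis with the pairs `(𝐏, 𝐐)` of standard
`B`-tableaux of the same shape.
-/

namespace FQ

/-! ### Row insertion -/

theorem rowInsert_cons_lt {a x : ℕ} (h : a < x) (r : List ℕ) :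
    rowInsert a (x :: r) = (a :: r, some x) := by simp [rowInsert, h]

theorem rowInsert_cons_le {a x : ℕ} (h : x ≤ a) (r : List ℕ) :
    rowInsert a (x :: r) = (x :: (rowInsert a r).1, (rowInsert a r).2) := by
  simp [rowInsert, not_lt.2 h]

theorem rowInsert_eq_none_iff {a : ℕ} {p : List ℕ} :
    (rowInsert a p).2 = none ↔ ∀ x ∈ p, x ≤ a := by
  induction p with
  | nil => simp [rowInsert]
  | cons x r ih =>
    rcases lt_or_ge a x with h | h
    · simp [rowInsert_cons_lt h, h]
    · simp [rowInsert_cons_le h, ih, h]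

theorem rowInsert_append {a : ℕ} {l : List ℕ} (hl : ∀ x ∈ l, x ≤ a) (r : List ℕ) :
    rowInsert a (l ++ r) = (l ++ (rowInsert a r).1, (rowInsert a r).2) := by
  induction l with
  | nil => rfl
  | cons x l ih =>
    rw [List.forall_mem_cons] at hl
    rw [List.cons_append, rowInsert_cons_le hl.1, ih hl.2, List.cons_append]

theorem rowInsert_of_le {a : ℕ} {p : List ℕ} (h : ∀ x ∈ p, x ≤ a) :
    rowInsert a p = (p ++ [a], none) := by
  simpa [rowInsert] using rowInsert_append h []

theorem rowInsert_of_eq_none {a : ℕ} {p : List ℕ} (h : (rowInsert a p).2 = none) :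
    (rowInsert a p).1 = p ++ [a] := by
  rw [rowInsert_of_le (rowInsert_eq_none_iff.1 h)]

theorem rowInsert_append_cons {a c : ℕ} {l : List ℕ} (hl : ∀ x ∈ l, x ≤ a) (hac : a < c)
    (r : List ℕ) : rowInsert a (l ++ c :: r) = (l ++ a :: r, some c) := by
  rw [rowInsert_append hl, rowInsert_cons_lt hac]

theorem exists_of_rowInsert_eq_some {a c : ℕ} {p : List ℕ} (h : (rowInsert a p).2 = some c) :
    ∃ l r, p = l ++ c :: r ∧ (rowInsert a p).1 = l ++ a :: r ∧ (∀ x ∈ l, x ≤ a) ∧ a < c := by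
  induction p with
  | nil => simp [rowInsert] at h
  | cons x p ih =>
    rcases lt_or_ge a x with hx | hx
    · rw [rowInsert_cons_lt hx, Option.some.injEq] at h
      subst h
      exact ⟨[], p, rfl, by rw [rowInsert_cons_lt hx, List.nil_append], by simp, hx⟩
    · rw [rowInsert_cons_le hx] at h ⊢
      obtain ⟨l, r, rfl, hr, hl, hac⟩ := ih h
      exact ⟨x :: l, r, rfl, by rw [hr, List.cons_append], List.forall_mem_cons.2 ⟨hx, hl⟩, hac⟩

theorem lt_of_rowInsert_eq_some {a c : ℕ} {p : List ℕ} (h : (rowInsert a p).2 = some c) :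
    a < c := by
  obtain ⟨-, -, -, -, -, hac⟩ := exists_of_rowInsert_eq_some h
  exact hac

theorem mem_of_rowInsert_eq_some {a c : ℕ} {p : List ℕ} (h : (rowInsert a p).2 = some c) :
    c ∈ p := by
  obtain ⟨l, r, rfl, -⟩ := exists_of_rowInsert_eq_some h
  simp

theorem length_rowInsert {a c : ℕ} {p : List ℕ} (h : (rowInsert a p).2 = some c) :
    (rowInsert a p).1.length = p.length := by
  obtain ⟨l, r, rfl, hr, -⟩ := exists_of_rowInsert_eq_some h
  simp [hr]

theorem rowInsert_append_of_eq_some {a c : ℕ} {p : List ℕ} (h : (rowInsert a p).2 = some c)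
    (s : List ℕ) : rowInsert a (p ++ s) = ((rowInsert a p).1 ++ s, some c) := by
  obtain ⟨l, r, rfl, hr, hl, hac⟩ := exists_of_rowInsert_eq_some h
  rw [hr, List.append_assoc, List.cons_append, rowInsert_append_cons hl hac, List.append_assoc,
    List.cons_append]

theorem rowInsert_perm (a : ℕ) (p : List ℕ) :
    ((rowInsert a p).1 ++ (rowInsert a p).2.toList).Perm (a :: p) := by
  induction p with
  | nil => simp [rowInsert]
  | cons x r ih =>
    rcases lt_or_ge a x with h | h
    · simpa only [rowInsert_cons_lt h, Option.toList_some, List.cons_append] using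
        List.Perm.cons a (List.perm_append_singleton x r)
    · rw [rowInsert_cons_le h]
      exact (List.Perm.cons x ih).trans (List.Perm.swap _ _ _)

theorem mem_rowInsert_self (a : ℕ) (p : List ℕ) : a ∈ (rowInsert a p).1 := by
  cases h : (rowInsert a p).2 with
  | none => simp [rowInsert_of_eq_none h]
  | some c =>
    obtain ⟨l, r, -, hr, -⟩ := exists_of_rowInsert_eq_some h
    simp [hr]

theorem rowInsert_ne_nil (a : ℕ) (p : List ℕ) : (rowInsert a p).1 ≠ [] :=
  List.ne_nil_of_mem (mem_rowInsert_self a p)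

theorem eq_or_mem_of_mem_rowInsert {a x : ℕ} {p : List ℕ} (h : x ∈ (rowInsert a p).1) :
    x = a ∨ x ∈ p :=
  List.mem_cons.1 ((rowInsert_perm a p).mem_iff.1 (List.mem_append_left _ h))

theorem pairwise_rowInsert {a : ℕ} {p : List ℕ} (h : p.Pairwise (· ≤ ·)) :
    (rowInsert a p).1.Pairwise (· ≤ ·) := by
  induction p with
  | nil => simp [rowInsert]
  | cons x r ih =>
    rw [List.pairwise_cons] at h
    rcases lt_or_ge a x with hx | hx
    · rw [rowInsert_cons_lt hx, List.pairwise_cons]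
      exact ⟨fun y hy => hx.le.trans (h.1 y hy), h.2⟩
    · rw [rowInsert_cons_le hx, List.pairwise_cons]
      refine ⟨fun y hy => ?_, ih h.2⟩
      rcases eq_or_mem_of_mem_rowInsert hy with rfl | hy
      exacts [hx, h.1 y hy]

theorem exists_rowInsert_eq {c : ℕ} {p : List ℕ} (hp : p.Pairwise (· ≤ ·))
    (hc : ∃ x ∈ p, x < c) :
    ∃ a p₀, p₀.Pairwise (· ≤ ·) ∧ rowInsert a p₀ = (p, some c) := by
  induction p with
  | nil => simp at hc
  | cons x p ih =>
    rw [List.pairwise_cons] at hp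
    by_cases h : ∃ y ∈ p, y < c
    · obtain ⟨a, p₀, hp₀, h₀⟩ := ih hp.2 h
      have hxa : x ≤ a := hp.1 a (by simpa [h₀] using mem_rowInsert_self a p₀)
      have hxc : x ≤ c := hxa.trans (lt_of_rowInsert_eq_some (congrArg Prod.snd h₀)).le
      refine ⟨a, x :: p₀, List.pairwise_cons.2 ⟨fun y hy => ?_, hp₀⟩, by
        rw [rowInsert_cons_le hxa, h₀]⟩
      have hyp : y ∈ p ∨ y = c := by
        simpa [h₀] using (rowInsert_perm a p₀).mem_iff.2 (List.mem_cons_of_mem a hy)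
      rcases hyp with hyp | rfl
      exacts [hp.1 y hyp, hxc]
    · have hx : x < c := by
        obtain ⟨y, hy, hyc⟩ := hc
        rcases List.mem_cons.1 hy with rfl | hy
        exacts [hyc, absurd ⟨y, hy, hyc⟩ h]
      push Not at h
      exact ⟨x, c :: p, List.pairwise_cons.2 ⟨h, hp.2⟩, rowInsert_cons_lt hx p⟩

/- The entries of `l ++ a :: r` that are smaller than `c` are those of `l ++ [a]`, so that the place
where `a` was inserted can be read off from the new row and the bumped letter. -/
theorem rowInsert_injective {a a' c : ℕ} {p p' : List ℕ} (hp : p.Pairwise (· ≤ ·))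
    (hp' : p'.Pairwise (· ≤ ·)) (h : (rowInsert a p).2 = some c)
    (h' : (rowInsert a' p').2 = some c) (heq : (rowInsert a p).1 = (rowInsert a' p').1) :
    a = a' ∧ p = p' := by
  obtain ⟨l, r, rfl, hlr, hl, hac⟩ := exists_of_rowInsert_eq_some h
  obtain ⟨l', r', rfl, hlr', hl', hac'⟩ := exists_of_rowInsert_eq_some h'
  have filter_lt : ∀ {a : ℕ} {l r : List ℕ}, (l ++ c :: r).Pairwise (· ≤ ·) → (∀ x ∈ l, x ≤ a) →
      a < c → (l ++ a :: r).filter (· < c) = l ++ [a] := by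
    intro a l r hs hl hac
    have hr := (List.pairwise_cons.1 (List.pairwise_append.1 hs).2.1).1
    rw [List.filter_append, List.filter_cons_of_pos (by simpa using hac),
      List.filter_eq_self.2 fun x hx => by simpa using (hl x hx).trans_lt hac,
      List.filter_eq_nil_iff.2 fun x hx => by simpa using hr x hx]
  rw [hlr, hlr'] at heq
  have hla : l ++ [a] = l' ++ [a'] := by
    rw [← filter_lt hp hl hac, heq, filter_lt hp' hl' hac']
  obtain ⟨rfl, ha⟩ := List.append_inj' hla rfl
  obtain rfl : a = a' := by simpa using ha
  obtain rfl : r = r' := by simpa using heq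
  exact ⟨rfl, rfl⟩

/-! ### Tableaux as lists of rows -/

/-- The row `q` can be placed under the row `p` in a tableau: it is not longer than `p`, and each of
its entries is larger than the one above it. -/
def Dominates : List ℕ → List ℕ → Prop
  | _, [] => True
  | [], _ :: _ => False
  | x :: p, y :: q => x < y ∧ Dominates p q

@[simp] theorem dominates_nil (p : List ℕ) : Dominates p [] := by cases p <;> trivial

@[simp] theorem not_nil_dominates_cons (y : ℕ) (q : List ℕ) : ¬ Dominates [] (y :: q) := id

@[simp] theorem cons_dominates_cons {x y : ℕ} {p q : List ℕ} :
    Dominates (x :: p) (y :: q) ↔ x < y ∧ Dominates p q := Iff.rfl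

theorem Dominates.length_le : ∀ {p q : List ℕ}, Dominates p q → q.length ≤ p.length
  | _, [], _ => Nat.zero_le _
  | _ :: _, _ :: _, h => Nat.succ_le_succ h.2.length_le

theorem Dominates.exists_lt : ∀ {p q : List ℕ}, Dominates p q → ∀ y ∈ q, ∃ x ∈ p, x < y
  | _, [], _ => by simp
  | x :: p, y :: q, h => by
    refine List.forall_mem_cons.2 ⟨⟨x, by simp, h.1⟩, fun z hz => ?_⟩
    obtain ⟨w, hw, hwz⟩ := h.2.exists_lt z hz
    exact ⟨w, List.mem_cons_of_mem x hw, hwz⟩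

theorem Dominates.of_append_right : ∀ {p q r : List ℕ}, Dominates p (q ++ r) → Dominates p q
  | _, [], _, _ => dominates_nil _
  | _ :: _, _ :: _, _, h => ⟨h.1, h.2.of_append_right⟩

theorem Dominates.of_append_left : ∀ {p q r : List ℕ}, Dominates (p ++ r) q →
    q.length ≤ p.length → Dominates p q
  | _, [], _, _, _ => dominates_nil _
  | [], _ :: _, _, _, hlen => absurd hlen (Nat.not_succ_le_zero _)
  | _ :: _, _ :: _, _, h, hlen => ⟨h.1, h.2.of_append_left (Nat.le_of_succ_le_succ hlen)⟩

theorem Dominates.of_append_singleton_left : ∀ {p q : List ℕ} {l : ℕ}, Dominates (p ++ [l]) q →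
    (∀ y ∈ q, y ≤ l) → Dominates p q
  | _, [], _, _, _ => dominates_nil _
  | [], y :: _, _, h, hq => absurd h.1 (hq y List.mem_cons_self).not_gt
  | _ :: _, _ :: _, _, h, hq =>
    ⟨h.1, h.2.of_append_singleton_left fun z hz => hq z (List.mem_cons_of_mem _ hz)⟩

theorem Dominates.rowInsert_left {p q : List ℕ} (h : Dominates p q) (a : ℕ) :
    Dominates (rowInsert a p).1 q := by
  induction p generalizing q with
  | nil =>
    cases q with
    | nil => simp
    | cons y q => exact h.elim
  | cons x p ih =>
    cases q with
    | nil => simp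
    | cons y q =>
      rcases lt_or_ge a x with hx | hx
      · rw [rowInsert_cons_lt hx]; exact ⟨hx.trans h.1, h.2⟩
      · rw [rowInsert_cons_le hx]; exact ⟨h.1, ih h.2⟩

theorem Dominates.rowInsert {p q : List ℕ} {a c : ℕ} (h : Dominates p q)
    (hc : (FQ.rowInsert a p).2 = some c) :
    Dominates (FQ.rowInsert a p).1 (FQ.rowInsert c q).1 := by
  induction p generalizing q with
  | nil => simp [FQ.rowInsert] at hc
  | cons x r ih =>
    rcases lt_or_ge a x with hx | hx
    · rw [rowInsert_cons_lt hx] at hc ⊢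
      obtain rfl : x = c := by simpa using hc
      cases q with
      | nil => simpa [FQ.rowInsert] using hx
      | cons y s => rw [rowInsert_cons_lt h.1]; exact ⟨hx, h.2⟩
    · rw [rowInsert_cons_le hx] at hc ⊢
      have hxc : x < c := hx.trans_lt (lt_of_rowInsert_eq_some hc)
      cases q with
      | nil => exact ⟨hxc, dominates_nil _⟩
      | cons y s =>
        rcases lt_or_ge c y with hy | hy
        · rw [rowInsert_cons_lt hy]; exact ⟨hxc, h.2.rowInsert_left a⟩
        · rw [rowInsert_cons_le hy]; exact ⟨h.1, ih h.2 hc⟩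

theorem Dominates.of_rowInsert_left {p q : List ℕ} {a c : ℕ}
    (h : Dominates (FQ.rowInsert a p).1 q) (hc : (FQ.rowInsert a p).2 = some c)
    (hq : ∀ y ∈ q, c < y) : Dominates p q := by
  induction p generalizing q with
  | nil => simp [FQ.rowInsert] at hc
  | cons x r ih =>
    cases q with
    | nil => simp
    | cons y s =>
      rw [List.forall_mem_cons] at hq
      rcases lt_or_ge a x with hx | hx
      · rw [rowInsert_cons_lt hx] at hc h
        obtain rfl : x = c := by simpa using hc
        exact ⟨hq.1, h.2⟩
      · rw [rowInsert_cons_le hx] at hc h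
        exact ⟨h.1, ih h.2 hc hq.2⟩

theorem Dominates.of_rowInsert {p q : List ℕ} {a c : ℕ}
    (h : Dominates (FQ.rowInsert a p).1 (FQ.rowInsert c q).1)
    (hc : (FQ.rowInsert a p).2 = some c) (hp : p.Pairwise (· ≤ ·)) (hq : q.Pairwise (· ≤ ·)) :
    Dominates p q := by
  induction p generalizing q with
  | nil => simp [FQ.rowInsert] at hc
  | cons x r ih =>
    cases q with
    | nil => simp
    | cons y s =>
      rw [List.pairwise_cons] at hp hq
      rcases lt_or_ge a x with hx | hx
      · rw [rowInsert_cons_lt hx] at hc h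
        obtain rfl : x = c := by simpa using hc
        rcases lt_or_ge x y with hy | hy
        · rw [rowInsert_cons_lt hy] at h; exact ⟨hy, h.2⟩
        · rw [rowInsert_cons_le hy] at h
          obtain ⟨z, hz, hzx⟩ := h.2.exists_lt x (mem_rowInsert_self x s)
          exact absurd hzx (not_lt.2 (hp.1 z hz))
      · rw [rowInsert_cons_le hx] at hc h
        rcases lt_or_ge c y with hy | hy
        · rw [rowInsert_cons_lt hy] at h
          exact ⟨h.1.trans hy, h.2.of_rowInsert_left hc fun z hz => hy.trans_le (hq.1 z hz)⟩
        · rw [rowInsert_cons_le hy] at h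
          exact ⟨h.1, ih h.2 hc hp.2 hq.2⟩

/-- A list of rows is that of a semistandard tableau. -/
def IsTableau : List (List ℕ) → Prop
  | [] => True
  | p :: t => p ≠ [] ∧ p.Pairwise (· ≤ ·) ∧ Dominates p (t.headD []) ∧ IsTableau t

@[simp] theorem isTableau_nil : IsTableau [] := trivial

theorem isTableau_cons {p : List ℕ} {t : List (List ℕ)} : IsTableau (p :: t) ↔
    p ≠ [] ∧ p.Pairwise (· ≤ ·) ∧ Dominates p (t.headD []) ∧ IsTableau t := Iff.rfl

/-- Schensted insertion of a letter in the rows of a tableau: the first component of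
`insertStep`. -/
def tabInsert : ℕ → List (List ℕ) → List (List ℕ)
  | a, [] => [[a]]
  | a, p :: t =>
    match rowInsert a p with
    | (p', none) => p' :: t
    | (p', some c) => p' :: tabInsert c t

theorem tabInsert_of_eq_none {a : ℕ} {p : List ℕ} (h : (rowInsert a p).2 = none)
    (t : List (List ℕ)) : tabInsert a (p :: t) = (p ++ [a]) :: t := by
  rw [tabInsert, rowInsert_of_le (rowInsert_eq_none_iff.1 h)]

theorem tabInsert_of_eq_some {a c : ℕ} {p : List ℕ} (h : (rowInsert a p).2 = some c)
    (t : List (List ℕ)) : tabInsert a (p :: t) = (rowInsert a p).1 :: tabInsert c t := by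
  rw [tabInsert, show rowInsert a p = ((rowInsert a p).1, some c) by rw [← h]]

theorem headD_tabInsert (a : ℕ) (t : List (List ℕ)) :
    (tabInsert a t).headD [] = (rowInsert a (t.headD [])).1 := by
  cases t with
  | nil => rfl
  | cons p t =>
    cases h : (rowInsert a p).2 with
    | none => simp [tabInsert_of_eq_none h, rowInsert_of_eq_none h]
    | some c => simp [tabInsert_of_eq_some h]

theorem IsTableau.tabInsert {t : List (List ℕ)} (h : IsTableau t) (a : ℕ) :
    IsTableau (tabInsert a t) := by
  induction t generalizing a with
  | nil => simp [FQ.tabInsert, isTableau_cons]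
  | cons p t ih =>
    obtain ⟨-, hsorted, hdom, ht⟩ := h
    cases hc : (rowInsert a p).2 with
    | none =>
      rw [tabInsert_of_eq_none hc, ← rowInsert_of_eq_none hc]
      exact ⟨rowInsert_ne_nil a p, pairwise_rowInsert hsorted, hdom.rowInsert_left a, ht⟩
    | some c =>
      rw [tabInsert_of_eq_some hc, isTableau_cons, headD_tabInsert]
      exact ⟨rowInsert_ne_nil a p, pairwise_rowInsert hsorted, hdom.rowInsert hc, ih ht c⟩

/-- Insertion of the letters of a word, from left to right, in the rows of a tableau. -/
def tabInsertWord (w : List ℕ) (t : List (List ℕ)) : List (List ℕ) :=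
  w.foldl (fun t a => tabInsert a t) t

theorem tabInsertWord_append (u v : List ℕ) (t : List (List ℕ)) :
    tabInsertWord (u ++ v) t = tabInsertWord v (tabInsertWord u t) := List.foldl_append

theorem isTableau_tabInsertWord (w : List ℕ) : IsTableau (tabInsertWord w []) := by
  induction w using List.reverseRecOn with
  | nil => exact isTableau_nil
  | append_singleton w x ih => rw [tabInsertWord_append]; exact ih.tabInsert x

/-! ### Schützenberger's symmetry -/

theorem insertStep_of_eq_none {a : ℕ} {p : List ℕ} (h : (rowInsert a p).2 = none) (j : ℕ)
    (q : List ℕ) (t : List (List ℕ × List ℕ)) :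
    insertStep j a ((p, q) :: t) = (p ++ [a], q ++ [j]) :: t := by
  rw [insertStep, rowInsert_of_le (rowInsert_eq_none_iff.1 h)]

theorem insertStep_of_eq_some {a c : ℕ} {p : List ℕ} (h : (rowInsert a p).2 = some c) (j : ℕ)
    (q : List ℕ) (t : List (List ℕ × List ℕ)) :
    insertStep j a ((p, q) :: t) = ((rowInsert a p).1, q) :: insertStep j c t := by
  rw [insertStep, show rowInsert a p = ((rowInsert a p).1, some c) by rw [← h]]

theorem map_fst_insertStep (j a : ℕ) (t : List (List ℕ × List ℕ)) :
    (insertStep j a t).map Prod.fst = tabInsert a (t.map Prod.fst) := by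
  induction t generalizing a with
  | nil => rfl
  | cons pq t ih =>
    obtain ⟨p, q⟩ := pq
    cases h : (rowInsert a p).2 with
    | none => simp [insertStep_of_eq_none h, tabInsert_of_eq_none h]
    | some c => simp [insertStep_of_eq_some h, tabInsert_of_eq_some h, ih]

/-- The entries of the first tableau of a pair `(P, Q)` given by its pairs of rows. -/
def letters (t : List (List ℕ × List ℕ)) : List ℕ := (t.map Prod.fst).flatten

/-- The entries of the second tableau of a pair `(P, Q)` given by its pairs of rows. -/
def labels (t : List (List ℕ × List ℕ)) : List ℕ := (t.map Prod.snd).flatten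

@[simp] theorem letters_cons (p q : List ℕ) (t : List (List ℕ × List ℕ)) :
    letters ((p, q) :: t) = p ++ letters t := rfl

@[simp] theorem labels_cons (p q : List ℕ) (t : List (List ℕ × List ℕ)) :
    labels ((p, q) :: t) = q ++ labels t := rfl

theorem letters_insertStep (j a : ℕ) (t : List (List ℕ × List ℕ)) :
    (letters (insertStep j a t)).Perm (a :: letters t) := by
  induction t generalizing a with
  | nil => simp [insertStep, letters]
  | cons pq t ih =>
    obtain ⟨p, q⟩ := pq
    cases h : (rowInsert a p).2 with
    | none => simp [insertStep_of_eq_none h]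
    | some c =>
      rw [insertStep_of_eq_some h, letters_cons, letters_cons]
      refine ((ih c).append_left _).trans ?_
      simpa [h] using (rowInsert_perm a p).append_right (letters t)

theorem labels_insertStep (j a : ℕ) (t : List (List ℕ × List ℕ)) :
    (labels (insertStep j a t)).Perm (j :: labels t) := by
  induction t generalizing a with
  | nil => simp [insertStep, labels]
  | cons pq t ih =>
    obtain ⟨p, q⟩ := pq
    cases h : (rowInsert a p).2 with
    | none => simp [insertStep_of_eq_none h]
    | some c =>
      rw [insertStep_of_eq_some h, labels_cons, labels_cons]
      exact ((ih c).append_left _).trans List.perm_middle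

/-- The tableaux of a pair `(P, Q)`, given by its pairs of rows, have the same shape. -/
def SameShape (t : List (List ℕ × List ℕ)) : Prop := ∀ pq ∈ t, pq.1.length = pq.2.length

@[simp] theorem sameShape_nil : SameShape [] := by simp [SameShape]

@[simp] theorem sameShape_cons {p q : List ℕ} {t : List (List ℕ × List ℕ)} :
    SameShape ((p, q) :: t) ↔ p.length = q.length ∧ SameShape t := List.forall_mem_cons

theorem SameShape.insertStep {t : List (List ℕ × List ℕ)} (h : SameShape t) (j a : ℕ) :
    SameShape (insertStep j a t) := by
  induction t generalizing a with
  | nil => simp [FQ.insertStep]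
  | cons pq t ih =>
    obtain ⟨p, q⟩ := pq
    rw [sameShape_cons] at h
    cases hc : (rowInsert a p).2 with
    | none => simpa [insertStep_of_eq_none hc] using h
    | some c =>
      rw [insertStep_of_eq_some hc, sameShape_cons, length_rowInsert hc]
      exact ⟨h.1, ih h.2 c⟩

/-- The insertion step in which the tableaux of a pair `(P, Q)` have exchanged their roles: the
label `i` is inserted in `Q`, and the letter `n` is put in the new box of `P`. -/
def coinsertStep (i n : ℕ) (t : List (List ℕ × List ℕ)) : List (List ℕ × List ℕ) :=
  (insertStep n i (t.map Prod.swap)).map Prod.swap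

theorem coinsertStep_of_eq_none {i : ℕ} {q : List ℕ} (h : (rowInsert i q).2 = none) (n : ℕ)
    (p : List ℕ) (t : List (List ℕ × List ℕ)) :
    coinsertStep i n ((p, q) :: t) = (p ++ [n], q ++ [i]) :: t := by
  simp [coinsertStep, insertStep_of_eq_none h]

theorem coinsertStep_of_eq_some {i c : ℕ} {q : List ℕ} (h : (rowInsert i q).2 = some c) (n : ℕ)
    (p : List ℕ) (t : List (List ℕ × List ℕ)) :
    coinsertStep i n ((p, q) :: t) = (p, (rowInsert i q).1) :: coinsertStep c n t := by
  simp [coinsertStep, insertStep_of_eq_some h]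

theorem insertStep_eq_coinsertStep {i n : ℕ} {t : List (List ℕ × List ℕ)}
    (hi : ∀ l ∈ labels t, l ≤ i) (hn : ∀ l ∈ letters t, l ≤ n) :
    insertStep i n t = coinsertStep i n t := by
  cases t with
  | nil => rfl
  | cons pq t =>
    obtain ⟨p, q⟩ := pq
    rw [insertStep_of_eq_none, coinsertStep_of_eq_none]
    · exact rowInsert_eq_none_iff.2 fun x hx => hi x (by simp [hx])
    · exact rowInsert_eq_none_iff.2 fun x hx => hn x (by simp [hx])

/- If the letter `a` and the label `i` both open a new box in the same row, then, whichever step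
comes first, the second one moves its largest entry, `n` or `j`, to the next row. -/
theorem insertStep_coinsertStep {i j a n : ℕ} {t : List (List ℕ × List ℕ)}
    (hj : ∀ l ∈ labels t, l < j) (hn : ∀ l ∈ letters t, l < n) (hi : i < j) (ha : a < n) :
    insertStep j a (coinsertStep i n t) = coinsertStep i n (insertStep j a t) := by
  have rowInsert_concat : ∀ {a n : ℕ} {p : List ℕ}, (rowInsert a p).2 = none → a < n →
      rowInsert a (p ++ [n]) = (p ++ [a], some n) :=
    fun h han => rowInsert_append_cons (rowInsert_eq_none_iff.1 h) han []
  induction t generalizing i a with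
  | nil => simp [insertStep, coinsertStep, rowInsert, ha, hi]
  | cons pq t ih =>
    obtain ⟨p, q⟩ := pq
    simp only [labels_cons, letters_cons, List.forall_mem_append] at hj hn
    cases hc : (rowInsert a p).2 with
    | none =>
      cases hd : (rowInsert i q).2 with
      | none =>
        rw [coinsertStep_of_eq_none hd, insertStep_of_eq_none hc,
          insertStep_of_eq_some (congrArg Prod.snd (rowInsert_concat hc ha)),
          coinsertStep_of_eq_some (congrArg Prod.snd (rowInsert_concat hd hi)),
          rowInsert_concat hc ha, rowInsert_concat hd hi,
          insertStep_eq_coinsertStep (fun l hl => (hj.2 l hl).le) fun l hl => (hn.2 l hl).le]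
      | some d =>
        have hd' := rowInsert_append_of_eq_some hd [j]
        rw [coinsertStep_of_eq_some hd, insertStep_of_eq_none hc, insertStep_of_eq_none hc,
          coinsertStep_of_eq_some (congrArg Prod.snd hd'), hd']
    | some c =>
      cases hd : (rowInsert i q).2 with
      | none =>
        have hc' := rowInsert_append_of_eq_some hc [n]
        rw [coinsertStep_of_eq_none hd, insertStep_of_eq_some hc, coinsertStep_of_eq_none hd,
          insertStep_of_eq_some (congrArg Prod.snd hc'), hc']
      | some d =>
        rw [coinsertStep_of_eq_some hd, insertStep_of_eq_some hc, insertStep_of_eq_some hc,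
          coinsertStep_of_eq_some hd, ih hj.2 hn.2 (hj.1 d (mem_of_rowInsert_eq_some hd))
            (hn.1 c (mem_of_rowInsert_eq_some hc))]

theorem robinsonSchensted_append_singleton (w : List (ℕ × ℕ)) (x : ℕ × ℕ) :
    robinsonSchensted (w ++ [x]) = insertStep x.1 x.2 (robinsonSchensted w) := by
  simp [robinsonSchensted]

theorem letters_robinsonSchensted (w : List (ℕ × ℕ)) :
    (letters (robinsonSchensted w)).Perm (w.map Prod.snd) := by
  induction w using List.reverseRecOn with
  | nil => exact .nil
  | append_singleton w x ih =>
    rw [robinsonSchensted_append_singleton, List.map_append]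
    exact (letters_insertStep _ _ _).trans ((ih.cons _).trans (List.perm_append_singleton _ _).symm)

theorem labels_robinsonSchensted (w : List (ℕ × ℕ)) :
    (labels (robinsonSchensted w)).Perm (w.map Prod.fst) := by
  induction w using List.reverseRecOn with
  | nil => exact .nil
  | append_singleton w x ih =>
    rw [robinsonSchensted_append_singleton, List.map_append]
    exact (labels_insertStep _ _ _).trans ((ih.cons _).trans (List.perm_append_singleton _ _).symm)

theorem sameShape_robinsonSchensted (w : List (ℕ × ℕ)) : SameShape (robinsonSchensted w) := by
  induction w using List.reverseRecOn with
  | nil => exact sameShape_nil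
  | append_singleton w x ih => rw [robinsonSchensted_append_singleton]; exact ih.insertStep _ _

theorem map_fst_robinsonSchensted (w : List (ℕ × ℕ)) :
    (robinsonSchensted w).map Prod.fst = tabInsertWord (w.map Prod.snd) [] := by
  induction w using List.reverseRecOn with
  | nil => rfl
  | append_singleton w x ih =>
    rw [robinsonSchensted_append_singleton, map_fst_insertStep, ih, List.map_append,
      tabInsertWord_append]
    rfl

theorem isTableau_map_fst_robinsonSchensted (w : List (ℕ × ℕ)) :
    IsTableau ((robinsonSchensted w).map Prod.fst) := by
  rw [map_fst_robinsonSchensted]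
  exact isTableau_tabInsertWord _

theorem robinsonSchensted_append_cons {u v : List (ℕ × ℕ)} {i n : ℕ}
    (hlabels : ((u ++ (i, n) :: v).map Prod.fst).Pairwise (· < ·))
    (hletters : ∀ x ∈ u ++ v, x.2 < n) :
    robinsonSchensted (u ++ (i, n) :: v) = coinsertStep i n (robinsonSchensted (u ++ v)) := by
  induction v using List.reverseRecOn with
  | nil =>
    simp only [List.map_append, List.pairwise_append, List.map_cons, List.map_nil,
      List.mem_singleton, forall_eq, List.append_nil] at hlabels hletters
    rw [robinsonSchensted_append_singleton, List.append_nil, insertStep_eq_coinsertStep]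
    · intro l hl
      exact (hlabels.2.2 l ((labels_robinsonSchensted u).mem_iff.1 hl)).le
    · intro l hl
      obtain ⟨x, hx, rfl⟩ := List.mem_map.1 ((letters_robinsonSchensted u).mem_iff.1 hl)
      exact (hletters x hx).le
  | append_singleton v x ih =>
    rw [← List.cons_append, ← List.append_assoc, List.map_append, List.pairwise_append] at hlabels
    simp only [List.map_cons, List.map_nil, List.mem_singleton, forall_eq] at hlabels
    rw [← List.append_assoc, List.forall_mem_append, List.forall_mem_singleton] at hletters
    rw [← List.cons_append, ← List.append_assoc, ← List.append_assoc,
      robinsonSchensted_append_singleton, robinsonSchensted_append_singleton,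
      ih hlabels.1 hletters.1, insertStep_coinsertStep _ _ (hlabels.2.2 i (by simp)) hletters.2]
    · intro l hl
      have hl := (labels_robinsonSchensted (u ++ v)).mem_iff.1 hl
      rw [List.map_append, List.mem_append] at hl
      exact hlabels.2.2 l (by simpa using hl.imp_right Or.inr)
    · intro l hl
      obtain ⟨y, hy, rfl⟩ := List.mem_map.1 ((letters_robinsonSchensted (u ++ v)).mem_iff.1 hl)
      exact hletters.1 y hy

/- The inverse of a word in two lines is obtained by exchanging the lines and sorting the columns.
Its column with the largest letter comes from the last letter of the word. -/
theorem robinsonSchensted_inverse {w w' : List (ℕ × ℕ)}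
    (hw : (w.map Prod.fst).Pairwise (· < ·)) (hw' : (w'.map Prod.fst).Pairwise (· < ·))
    (h : w'.Perm (w.map Prod.swap)) :
    robinsonSchensted w' = (robinsonSchensted w).map Prod.swap := by
  induction w using List.reverseRecOn generalizing w' with
  | nil => rw [List.perm_nil.1 h]; rfl
  | append_singleton w x ih =>
    obtain ⟨n, i⟩ := x
    obtain ⟨u, v, rfl⟩ := List.append_of_mem (h.mem_iff.2 (by simp : (i, n) ∈ _))
    rw [List.map_append, List.map_singleton] at h
    have huv : (u ++ v).Perm (w.map Prod.swap) :=
      List.Perm.cons_inv (List.perm_middle.symm.trans (h.trans (List.perm_append_singleton _ _)))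
    have hlt : ∀ x ∈ u ++ v, x.2 < n := fun x hx => by
      obtain ⟨y, hy, rfl⟩ := List.mem_map.1 (huv.mem_iff.1 hx)
      rw [List.map_append, List.pairwise_append] at hw
      exact hw.2.2 _ (List.mem_map_of_mem hy) n (by simp)
    have hsub : ((u ++ v).map Prod.fst).Sublist ((u ++ (i, n) :: v).map Prod.fst) :=
      ((List.Sublist.refl u).append (List.sublist_cons_self _ v)).map Prod.fst
    rw [robinsonSchensted_append_cons hw' hlt,
      ih (hw.sublist ((List.sublist_append_left w _).map Prod.fst)) (hw'.sublist hsub) huv,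
      robinsonSchensted_append_singleton, coinsertStep, List.map_map, Prod.swap_swap_eq,
      List.map_id]

/-! ### Reverse insertion -/

theorem insertStep_nil_ne_insertStep_cons {j : ℕ} {p q : List ℕ} (hp : p ≠ [])
    (hlen : p.length = q.length) (hj : j ∉ q) (a a' : ℕ) (t : List (List ℕ × List ℕ)) :
    insertStep j a [] ≠ insertStep j a' ((p, q) :: t) := by
  intro h
  cases hc : (rowInsert a' p).2 with
  | none =>
    rw [insertStep_of_eq_none hc, insertStep, List.cons.injEq, Prod.mk.injEq,
      List.self_eq_append_left] at h
    rw [h.1.2, List.length_nil, List.length_eq_zero_iff] at hlen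
    exact hp hlen
  | some c =>
    rw [insertStep_of_eq_some hc, insertStep, List.cons.injEq, Prod.mk.injEq] at h
    simp [← h.1.2] at hj

theorem insertStep_injective {j a a' : ℕ} {t t' : List (List ℕ × List ℕ)}
    (ht : IsTableau (t.map Prod.fst)) (ht' : IsTableau (t'.map Prod.fst))
    (hs : SameShape t) (hs' : SameShape t') (hj : j ∉ labels t) (hj' : j ∉ labels t')
    (h : insertStep j a t = insertStep j a' t') : a = a' ∧ t = t' := by
  induction t generalizing t' a a' with
  | nil =>
    cases t' with
    | nil => simpa [insertStep] using h
    | cons pq' t' =>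
      obtain ⟨p', q'⟩ := pq'
      simp only [labels_cons, sameShape_cons, List.mem_append, not_or] at hs' hj'
      exact absurd h (insertStep_nil_ne_insertStep_cons ht'.1 hs'.1 hj'.1 _ _ _)
  | cons pq t ih =>
    obtain ⟨p, q⟩ := pq
    simp only [labels_cons, sameShape_cons, List.mem_append, not_or] at hs hj
    cases t' with
    | nil => exact absurd h.symm (insertStep_nil_ne_insertStep_cons ht.1 hs.1 hj.1 _ _ _)
    | cons pq' t' =>
      obtain ⟨p', q'⟩ := pq'
      simp only [labels_cons, sameShape_cons, List.mem_append, not_or] at hs' hj'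
      cases hc : (rowInsert a p).2 with
      | none =>
        cases hc' : (rowInsert a' p').2 with
        | none =>
          simp only [insertStep_of_eq_none hc, insertStep_of_eq_none hc', List.cons.injEq,
            Prod.mk.injEq, List.append_singleton_inj, and_true] at h
          obtain ⟨⟨⟨rfl, rfl⟩, rfl⟩, rfl⟩ := h
          exact ⟨rfl, rfl⟩
        | some c' =>
          simp only [insertStep_of_eq_none hc, insertStep_of_eq_some hc', List.cons.injEq,
            Prod.mk.injEq] at h
          simp [← h.1.2] at hj'
      | some c =>
        cases hc' : (rowInsert a' p').2 with
        | none =>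
          simp only [insertStep_of_eq_some hc, insertStep_of_eq_none hc', List.cons.injEq,
            Prod.mk.injEq] at h
          simp [h.1.2] at hj
        | some c' =>
          simp only [insertStep_of_eq_some hc, insertStep_of_eq_some hc', List.cons.injEq,
            Prod.mk.injEq] at h
          obtain ⟨⟨hrow, rfl⟩, hrest⟩ := h
          obtain ⟨rfl, rfl⟩ := ih ht.2.2.2 ht'.2.2.2 hs.2 hs'.2 hj.2 hj'.2 hrest
          obtain ⟨rfl, rfl⟩ := rowInsert_injective ht.2.1 ht'.2.1 hc hc' hrow
          exact ⟨rfl, rfl⟩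

theorem robinsonSchensted_injective {w w' : List (ℕ × ℕ)}
    (hw : (w.map Prod.fst).Pairwise (· < ·)) (hw' : (w'.map Prod.fst).Pairwise (· < ·))
    (h : robinsonSchensted w = robinsonSchensted w') : w = w' := by
  have hlabels : w.map Prod.fst = w'.map Prod.fst :=
    ((labels_robinsonSchensted w).symm.trans (h ▸ labels_robinsonSchensted w')).eq_of_pairwise
      (fun _ _ _ _ hlt hgt => absurd hlt hgt.not_gt) hw hw'
  induction w using List.reverseRecOn generalizing w' with
  | nil => simpa using hlabels.symm
  | append_singleton w x ih =>
    rcases List.eq_nil_or_concat' w' with rfl | ⟨w', x', rfl⟩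
    · simp at hlabels
    rw [robinsonSchensted_append_singleton, robinsonSchensted_append_singleton] at h
    simp only [List.map_append, List.map_cons, List.map_nil, List.append_singleton_inj,
      List.pairwise_append, List.mem_singleton, forall_eq] at hlabels hw hw'
    rw [hlabels.2] at h
    obtain ⟨hletter, hpair⟩ := insertStep_injective (isTableau_map_fst_robinsonSchensted w)
      (isTableau_map_fst_robinsonSchensted w') (sameShape_robinsonSchensted w)
      (sameShape_robinsonSchensted w')
      (fun hx => (hw.2.2 _ ((labels_robinsonSchensted w).mem_iff.1 hx)).ne hlabels.2.symm)
      (fun hx => (hw'.2.2 _ ((labels_robinsonSchensted w').mem_iff.1 hx)).ne rfl) h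
    rw [ih hw.1 hw'.1 hpair hlabels.1, Prod.ext hlabels.2 hletter]

/-- A pair of semistandard tableaux of the same shape, given by its pairs of rows. -/
structure IsTableauPair (t : List (List ℕ × List ℕ)) : Prop where
  fst : IsTableau (t.map Prod.fst)
  snd : IsTableau (t.map Prod.snd)
  sameShape : SameShape t

theorem isTableauPair_nil : IsTableauPair [] := ⟨trivial, trivial, sameShape_nil⟩

theorem isTableauPair_cons {p q : List ℕ} {t : List (List ℕ × List ℕ)} :
    IsTableauPair ((p, q) :: t) ↔
      (p ≠ [] ∧ p.Pairwise (· ≤ ·) ∧ Dominates p ((t.map Prod.fst).headD [])) ∧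
      (q ≠ [] ∧ q.Pairwise (· ≤ ·) ∧ Dominates q ((t.map Prod.snd).headD [])) ∧
      p.length = q.length ∧ IsTableauPair t := by
  constructor
  · rintro ⟨⟨hp, hp', hp'', ht⟩, ⟨hq, hq', hq'', ht'⟩, hs⟩
    rw [sameShape_cons] at hs
    exact ⟨⟨hp, hp', hp''⟩, ⟨hq, hq', hq''⟩, hs.1, ht, ht', hs.2⟩
  · rintro ⟨⟨hp, hp', hp''⟩, ⟨hq, hq', hq''⟩, hlen, ht⟩
    exact ⟨⟨hp, hp', hp'', ht.fst⟩, ⟨hq, hq', hq'', ht.snd⟩, sameShape_cons.2 ⟨hlen, ht.sameShape⟩⟩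

theorem dominates_of_insertStep {q : List ℕ} {j c : ℕ} {t : List (List ℕ × List ℕ)}
    (h : Dominates q (((insertStep j c t).map Prod.snd).headD [])) :
    Dominates q ((t.map Prod.snd).headD []) := by
  cases t with
  | nil => simp
  | cons pq t =>
    cases hc : (rowInsert c pq.1).2 with
    | none => rw [insertStep_of_eq_none hc] at h; exact h.of_append_right
    | some d => rw [insertStep_of_eq_some hc] at h; exact h

theorem IsTableau.pairwise_headD {t : List (List ℕ)} (h : IsTableau t) :
    (t.headD []).Pairwise (· ≤ ·) := by
  cases t with
  | nil => simp
  | cons p t => exact h.2.1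

theorem IsTableau.eq_nil_of_nil_dominates {t : List (List ℕ)} (ht : IsTableau t)
    (h : Dominates [] (t.headD [])) : t = [] := by
  cases t with
  | nil => rfl
  | cons p t => exact absurd (List.length_eq_zero_iff.1 (Nat.le_zero.1 h.length_le)) ht.1

theorem SameShape.length_headD {t : List (List ℕ × List ℕ)} (h : SameShape t) :
    ((t.map Prod.fst).headD []).length = ((t.map Prod.snd).headD []).length := by
  cases t with
  | nil => rfl
  | cons pq t => exact h pq List.mem_cons_self

/- The largest label is at the end of its row, and there is no box under it. -/
theorem exists_insertStep_eq_of_mem_head {p q : List ℕ} {t : List (List ℕ × List ℕ)}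
    (ht : IsTableauPair ((p, q) :: t)) {j : ℕ} (hj : j ∈ q)
    (hmax : ∀ l ∈ labels ((p, q) :: t), l ≤ j) :
    ∃ a t₀, insertStep j a t₀ = (p, q) :: t ∧ IsTableauPair t₀ := by
  obtain ⟨⟨hp, hpsorted, hpdom⟩, ⟨hq, hqsorted, hqdom⟩, hlen, htail⟩ := isTableauPair_cons.1 ht
  simp only [labels_cons, List.forall_mem_append] at hmax
  obtain ⟨q, l, rfl⟩ := (List.eq_nil_or_concat' q).resolve_left hq
  obtain ⟨p, a, rfl⟩ := (List.eq_nil_or_concat' p).resolve_left hp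
  simp only [List.pairwise_append, List.mem_singleton, forall_eq] at hpsorted hqsorted
  obtain rfl : l = j := by
    refine le_antisymm (hmax.1 l (by simp)) ?_
    rcases List.mem_append.1 hj with hj | hj
    exacts [hqsorted.2.2 j hj, (List.mem_singleton.1 hj).le]
  have hlen' : p.length = q.length := by simpa using hlen
  have hqdom' : Dominates q ((t.map Prod.snd).headD []) := by
    refine hqdom.of_append_singleton_left fun y hy => hmax.2 y ?_
    cases t with
    | nil => simp at hy
    | cons pq t => exact List.mem_append_left _ hy
  rcases eq_or_ne q [] with rfl | hq'
  · rw [List.length_nil, List.length_eq_zero_iff] at hlen'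
    obtain rfl := List.map_eq_nil_iff.1 (htail.snd.eq_nil_of_nil_dominates hqdom')
    exact ⟨a, [], by rw [hlen']; rfl, isTableauPair_nil⟩
  · have hp' : p ≠ [] := by rwa [← List.length_pos_iff, hlen', List.length_pos_iff]
    have hpdom' : Dominates p ((t.map Prod.fst).headD []) := by
      refine hpdom.of_append_left ?_
      rw [htail.sameShape.length_headD, hlen']
      exact hqdom'.length_le
    refine ⟨a, (p, q) :: t, insertStep_of_eq_none (rowInsert_eq_none_iff.2 hpsorted.2.2) _ _ _, ?_⟩
    exact isTableauPair_cons.2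
      ⟨⟨hp', hpsorted.1, hpdom'⟩, ⟨hq', hqsorted.1, hqdom'⟩, hlen', htail⟩

theorem exists_insertStep_eq {t : List (List ℕ × List ℕ)} (ht : IsTableauPair t) {j : ℕ}
    (hj : j ∈ labels t) (hmax : ∀ l ∈ labels t, l ≤ j) :
    ∃ a t₀, insertStep j a t₀ = t ∧ IsTableauPair t₀ := by
  induction t with
  | nil => exact absurd hj List.not_mem_nil
  | cons pq t ih =>
    obtain ⟨p, q⟩ := pq
    rcases List.mem_append.1 hj with hjq | hjt
    · exact exists_insertStep_eq_of_mem_head ht hjq hmax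
    · obtain ⟨⟨hp, hpsorted, hpdom⟩, ⟨hq, hqsorted, hqdom⟩, hlen, htail⟩ := isTableauPair_cons.1 ht
      obtain ⟨c, t₀, rfl, ht₀⟩ := ih htail hjt fun l hl => hmax l (List.mem_append_right q hl)
      rw [map_fst_insertStep, headD_tabInsert] at hpdom
      obtain ⟨a, p₀, hp₀, heq⟩ :=
        exists_rowInsert_eq hpsorted (hpdom.exists_lt c (mem_rowInsert_self c _))
      have hbump : (rowInsert a p₀).2 = some c := congrArg Prod.snd heq
      obtain rfl : (rowInsert a p₀).1 = p := congrArg Prod.fst heq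
      refine ⟨a, (p₀, q) :: t₀, insertStep_of_eq_some hbump _ _ _, isTableauPair_cons.2
        ⟨⟨List.ne_nil_of_mem (mem_of_rowInsert_eq_some hbump), hp₀, ?_⟩,
          ⟨hq, hqsorted, dominates_of_insertStep hqdom⟩, ?_, ht₀⟩⟩
      · exact hpdom.of_rowInsert hbump hp₀ ht₀.fst.pairwise_headD
      · rw [← length_rowInsert hbump, hlen]

theorem exists_robinsonSchensted_eq {t : List (List ℕ × List ℕ)} (ht : IsTableauPair t)
    (hnodup : (labels t).Nodup) :
    ∃ w : List (ℕ × ℕ), (w.map Prod.fst).Pairwise (· < ·) ∧ robinsonSchensted w = t := by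
  induction hn : (labels t).length generalizing t with
  | zero =>
    cases t with
    | nil => exact ⟨[], by simp, rfl⟩
    | cons pq t =>
      rw [List.length_eq_zero_iff, labels_cons, List.append_eq_nil_iff] at hn
      exact absurd hn.1 ht.snd.1
  | succ n ih =>
    have hne : (labels t).toFinset.Nonempty := by
      rw [List.toFinset_nonempty_iff, ← List.length_pos_iff, hn]
      exact n.succ_pos
    obtain ⟨j, hj, hmax⟩ := (labels t).toFinset.exists_max_image id hne
    simp only [List.mem_toFinset, id] at hj hmax
    obtain ⟨a, t₀, rfl, ht₀⟩ := exists_insertStep_eq ht hj hmax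
    have hperm := labels_insertStep j a t₀
    obtain ⟨hj₀, hnodup₀⟩ := List.nodup_cons.1 (hperm.nodup_iff.1 hnodup)
    obtain ⟨w, hw, rfl⟩ := ih ht₀ hnodup₀ (by simpa [hn] using hperm.length_eq.symm)
    refine ⟨w ++ [(j, a)], ?_, robinsonSchensted_append_singleton _ _⟩
    simp only [List.map_append, List.pairwise_append, List.map_cons, List.map_nil,
      List.pairwise_singleton, List.mem_singleton, forall_eq, true_and]
    refine ⟨hw, fun l hl => ?_⟩
    have hl' := (labels_robinsonSchensted w).mem_iff.2 hl
    exact lt_of_le_of_ne (hmax l (hperm.mem_iff.2 (List.mem_cons_of_mem j hl')))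
      fun h => hj₀ (h ▸ hl')
/-! ### Knuth equivalence -/

section Knuth

variable {B : Type*}

theorem Knuth.symm {w w' : List (ℕ × B)} (h : Knuth w w') : Knuth w' w := by
  cases h with
  | exchange u v x y h => exact .exchange u v y x h.symm
  | acb_cab u v a b c β h h' => exact .cab_acb u v a b c β h h'
  | cab_acb u v a b c β h h' => exact .acb_cab u v a b c β h h'
  | bac_bca u v a b c β h h' => exact .bca_bac u v a b c β h h'
  | bca_bac u v a b c β h h' => exact .bac_bca u v a b c β h h'

theorem Knuth.append_append {w w' : List (ℕ × B)} (h : Knuth w w') (x y : List (ℕ × B)) :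
    Knuth (x ++ w ++ y) (x ++ w' ++ y) := by
  cases h with
  | exchange u v p q h => simpa using Knuth.exchange (x ++ u) (v ++ y) p q h
  | acb_cab u v a b c β h h' => simpa using Knuth.acb_cab (x ++ u) (v ++ y) a b c β h h'
  | cab_acb u v a b c β h h' => simpa using Knuth.cab_acb (x ++ u) (v ++ y) a b c β h h'
  | bac_bca u v a b c β h h' => simpa using Knuth.bac_bca (x ++ u) (v ++ y) a b c β h h'
  | bca_bac u v a b c β h h' => simpa using Knuth.bca_bac (x ++ u) (v ++ y) a b c β h h'

theorem Knuth.perm {w w' : List (ℕ × B)} (h : Knuth w w') : w.Perm w' := by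
  have perm_infix (u v : List (ℕ × B)) {x y : List (ℕ × B)} (h : x.Perm y) :
      (u ++ x ++ v).Perm (u ++ y ++ v) := (h.append_left u).append_right v
  cases h with
  | exchange u v x y h => exact perm_infix _ _ (.swap _ _ _)
  | acb_cab u v a b c β h h' => exact perm_infix _ _ (.swap _ _ _)
  | cab_acb u v a b c β h h' => exact perm_infix _ _ (.swap _ _ _)
  | bac_bca u v a b c β h h' => exact perm_infix _ _ (.cons _ (.swap _ _ _))
  | bca_bac u v a b c β h h' => exact perm_infix _ _ (.cons _ (.swap _ _ _))

/-- Two words are related by a sequence of Knuth relations. -/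
def KnuthEquiv (w w' : List (ℕ × B)) : Prop := Relation.ReflTransGen Knuth w w'

theorem KnuthEquiv.refl (w : List (ℕ × B)) : KnuthEquiv w w := Relation.ReflTransGen.refl

theorem KnuthEquiv.trans {w w' w'' : List (ℕ × B)} (h : KnuthEquiv w w')
    (h' : KnuthEquiv w' w'') : KnuthEquiv w w'' := Relation.ReflTransGen.trans h h'

theorem Knuth.equiv {w w' : List (ℕ × B)} (h : Knuth w w') : KnuthEquiv w w' :=
  Relation.ReflTransGen.single h

theorem KnuthEquiv.symm {w w' : List (ℕ × B)} (h : KnuthEquiv w w') : KnuthEquiv w' w := by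
  induction h with
  | refl => exact .refl _
  | tail _ h ih => exact h.symm.equiv.trans ih

theorem KnuthEquiv.append_append {w w' : List (ℕ × B)} (h : KnuthEquiv w w')
    (x y : List (ℕ × B)) : KnuthEquiv (x ++ w ++ y) (x ++ w' ++ y) := by
  induction h with
  | refl => exact .refl _
  | tail _ h ih => exact ih.trans (h.append_append x y).equiv

theorem KnuthEquiv.append_left {w w' : List (ℕ × B)} (h : KnuthEquiv w w') (x : List (ℕ × B)) :
    KnuthEquiv (x ++ w) (x ++ w') := by simpa using h.append_append x []

theorem KnuthEquiv.append_right {w w' : List (ℕ × B)} (h : KnuthEquiv w w') (x : List (ℕ × B)) :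
    KnuthEquiv (w ++ x) (w' ++ x) := by simpa using h.append_append [] x

theorem KnuthEquiv.cons {w w' : List (ℕ × B)} (h : KnuthEquiv w w') (x : ℕ × B) :
    KnuthEquiv (x :: w) (x :: w') := h.append_left [x]

theorem knuthEquiv_cons_append {x : ℕ × B} {w : List (ℕ × B)} (h : ∀ y ∈ w, y.2 ≠ x.2) :
    KnuthEquiv (x :: w) (w ++ [x]) := by
  induction w with
  | nil => exact .refl _
  | cons y w ih =>
    simp only [List.forall_mem_cons] at h
    exact (Knuth.exchange [] w x y h.1.symm).equiv.trans ((ih h.2).cons y)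

theorem knuthEquiv_filter_append_filter (p : B → Bool) (w : List (ℕ × B)) :
    KnuthEquiv w (w.filter (fun x => p x.2) ++ w.filter (fun x => !p x.2)) := by
  induction w with
  | nil => exact .refl _
  | cons x w ih =>
    cases hx : p x.2 with
    | true => simpa [hx] using ih.cons x
    | false =>
      have h : ∀ y ∈ w.filter (fun x => p x.2), y.2 ≠ x.2 := fun y hy h => by
        simp [h, hx] at hy
      simpa [hx] using (ih.cons x).trans
        ((knuthEquiv_cons_append h).append_right (w.filter (fun x => !p x.2)))

theorem knuthEquiv_flatMap_filter [DecidableEq B] {bs : List B} {w : List (ℕ × B)}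
    (hbs : bs.Nodup) (h : ∀ x ∈ w, x.2 ∈ bs) :
    KnuthEquiv w (bs.flatMap fun b => w.filter fun x => x.2 = b) := by
  induction bs generalizing w with
  | nil =>
    cases w with
    | nil => exact .refl _
    | cons x w => exact absurd (h x List.mem_cons_self) List.not_mem_nil
  | cons b bs ih =>
    rw [List.nodup_cons] at hbs
    refine (knuthEquiv_filter_append_filter (fun c => c = b) w).trans ?_
    rw [List.flatMap_cons]
    refine KnuthEquiv.append_left ?_ _
    have hfilter : ∀ c ∈ bs, (w.filter fun x => !decide (x.2 = b)).filter (fun x => x.2 = c) =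
        w.filter fun x => x.2 = c := fun c hc => by
      rw [List.filter_filter]
      refine List.filter_congr fun x _ => ?_
      have : c ≠ b := fun hcb => hbs.1 (hcb ▸ hc)
      grind
    have hrest := ih (w := w.filter fun x => !decide (x.2 = b)) hbs.2 fun x hx => by
      obtain ⟨hxw, hxb⟩ := List.mem_filter.1 hx
      exact (List.mem_cons.1 (h x hxw)).resolve_left (by simpa using hxb)
    rwa [List.flatMap_congr hfilter] at hrest

/-- The word with letters in `ℕ × {β}` attached to a word with letters in `ℕ`. -/
def coloured (β : B) (l : List ℕ) : List (ℕ × B) := l.map fun a => (a, β)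

theorem coloured_append (β : B) (l l' : List ℕ) :
    coloured β (l ++ l') = coloured β l ++ coloured β l' := List.map_append

theorem knuthEquiv_cons_append_of_lt (β : B) {x a : ℕ} {r : List ℕ}
    (hr : (x :: r).Pairwise (· ≤ ·)) (ha : a < x) :
    KnuthEquiv (coloured β (x :: (r ++ [a]))) (coloured β (x :: a :: r)) := by
  induction r generalizing x with
  | nil => exact .refl _
  | cons y r ih =>
    rw [List.pairwise_cons] at hr
    have hxy := hr.1 y (by simp)
    refine ((ih hr.2 (ha.trans_le hxy)).cons (x, β)).trans (Knuth.equiv ?_)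
    exact Knuth.bca_bac [] (coloured β r) a x y β ha hxy

theorem knuthEquiv_rowInsert (β : B) {a : ℕ} {p : List ℕ} (hp : p.Pairwise (· ≤ ·)) :
    KnuthEquiv (coloured β (p ++ [a]))
      (coloured β ((rowInsert a p).2.toList ++ (rowInsert a p).1)) := by
  induction p with
  | nil => exact .refl _
  | cons x r ih =>
    rcases lt_or_ge a x with hax | hxa
    · rw [rowInsert_cons_lt hax]; exact knuthEquiv_cons_append_of_lt β hp hax
    · rw [List.pairwise_cons] at hp
      rw [rowInsert_cons_le hxa]
      cases hc : (rowInsert a r).2 with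
      | none => rw [rowInsert_of_eq_none hc]; exact .refl _
      | some c =>
        obtain ⟨y, s, hys⟩ := List.exists_cons_of_ne_nil (rowInsert_ne_nil a r)
        have hxy : x ≤ y := by
          rcases eq_or_mem_of_mem_rowInsert (hys ▸ List.mem_cons_self : y ∈ (rowInsert a r).1)
            with rfl | hyr
          exacts [hxa, hp.1 y hyr]
        have hyc : y < c := by
          have hsorted := pairwise_rowInsert (a := a) hp.2
          have hmem := mem_rowInsert_self a r
          rw [hys, List.pairwise_cons] at hsorted
          rw [hys] at hmem
          have hac := lt_of_rowInsert_eq_some hc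
          rcases List.mem_cons.1 hmem with rfl | has
          exacts [hac, (hsorted.1 a has).trans_lt hac]
        have hbump := (ih hp.2).cons (x, β)
        rw [hc] at hbump
        refine hbump.trans ?_
        rw [hys]
        exact (Knuth.acb_cab [] (coloured β s) x y c β hxy hyc).equiv

/-- The word obtained by reading the rows of a tableau from bottom to top. -/
def readingWord (t : List (List ℕ)) : List ℕ := t.reverse.flatten

theorem readingWord_cons (p : List ℕ) (t : List (List ℕ)) :
    readingWord (p :: t) = readingWord t ++ p := by simp [readingWord]

theorem knuthEquiv_tabInsert (β : B) {a : ℕ} {t : List (List ℕ)} (ht : IsTableau t) :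
    KnuthEquiv (coloured β (readingWord t ++ [a])) (coloured β (readingWord (tabInsert a t))) := by
  induction t generalizing a with
  | nil => exact .refl _
  | cons p t ih =>
    cases hc : (rowInsert a p).2 with
    | none => simpa [tabInsert_of_eq_none hc, readingWord_cons] using KnuthEquiv.refl _
    | some c =>
      have h := knuthEquiv_rowInsert β (a := a) ht.2.1
      rw [hc] at h
      rw [tabInsert_of_eq_some hc, readingWord_cons, readingWord_cons, List.append_assoc,
        coloured_append]
      refine (h.append_left _).trans ?_
      rw [← coloured_append, ← List.append_assoc, coloured_append, Option.toList_some,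
        coloured_append β (readingWord (tabInsert c t))]
      exact (ih ht.2.2.2).append_right _

theorem knuthEquiv_readingWord (β : B) (w : List ℕ) :
    KnuthEquiv (coloured β w) (coloured β (readingWord (tabInsertWord w []))) := by
  induction w using List.reverseRecOn with
  | nil => exact .refl _
  | append_singleton w x ih =>
    rw [tabInsertWord_append, coloured_append]
    refine (ih.append_right _).trans ?_
    rw [← coloured_append]
    exact knuthEquiv_tabInsert β (isTableau_tabInsertWord w)

end Knuth

/-! ### Knuth's theorem -/

/-- The elementary Knuth relations on words of three letters. -/
inductive KnuthTriple : List ℕ → List ℕ → Prop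
  | acb_cab {a b c : ℕ} (hab : a ≤ b) (hbc : b < c) : KnuthTriple [a, c, b] [c, a, b]
  | bac_bca {a b c : ℕ} (hab : a < b) (hbc : b ≤ c) : KnuthTriple [b, a, c] [b, c, a]

/-- The row obtained by inserting the letters of a word, and the word formed by the letters bumped
from it. -/
def rowInsertWord : List ℕ → List ℕ → List ℕ × List ℕ
  | [], p => (p, [])
  | a :: w, p =>
    ((rowInsertWord w (rowInsert a p).1).1,
      (rowInsert a p).2.toList ++ (rowInsertWord w (rowInsert a p).1).2)

theorem tabInsertWord_cons (w : List ℕ) (p : List ℕ) (t : List (List ℕ)) :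
    tabInsertWord w (p :: t) = (rowInsertWord w p).1 :: tabInsertWord (rowInsertWord w p).2 t := by
  induction w generalizing p t with
  | nil => rfl
  | cons a w ih =>
    simp only [tabInsertWord, List.foldl_cons, rowInsertWord] at ih ⊢
    cases hc : (rowInsert a p).2 with
    | none => rw [tabInsert_of_eq_none hc, ih, rowInsert_of_eq_none hc]; simp
    | some c => rw [tabInsert_of_eq_some hc, ih]; simp

theorem rowInsertWord_cons_le {w : List ℕ} {x : ℕ} (h : ∀ a ∈ w, x ≤ a) (r : List ℕ) :
    rowInsertWord w (x :: r) = (x :: (rowInsertWord w r).1, (rowInsertWord w r).2) := by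
  induction w generalizing r with
  | nil => rfl
  | cons a w ih =>
    rw [List.forall_mem_cons] at h
    simp only [rowInsertWord, rowInsert_cons_le h.1, ih h.2]

theorem le_of_rowInsert_eq_some {a c e : ℕ} {p : List ℕ} (hp : p.Pairwise (· ≤ ·))
    (hc : (rowInsert a p).2 = some c) (he : e ∈ p) (hae : a < e) : c ≤ e := by
  induction p with
  | nil => simp at he
  | cons x r ih =>
    rw [List.pairwise_cons] at hp
    rcases lt_or_ge a x with h | h
    · rw [rowInsert_cons_lt h] at hc
      obtain rfl : x = c := by simpa using hc
      rcases List.mem_cons.1 he with rfl | he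
      exacts [le_rfl, hp.1 e he]
    · rw [rowInsert_cons_le h] at hc
      rcases List.mem_cons.1 he with rfl | he
      exacts [absurd hae h.not_gt, ih hp.2 hc he]

theorem rowInsertWord_acb_cab {a b c : ℕ} (hab : a ≤ b) (hbc : b < c) {p : List ℕ}
    (hp : p.Pairwise (· ≤ ·)) :
    (rowInsertWord [a, c, b] p).1 = (rowInsertWord [c, a, b] p).1 ∧
      ((rowInsertWord [a, c, b] p).2 = (rowInsertWord [c, a, b] p).2 ∨
        KnuthTriple (rowInsertWord [a, c, b] p).2 (rowInsertWord [c, a, b] p).2 ∨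
        KnuthTriple (rowInsertWord [c, a, b] p).2 (rowInsertWord [a, c, b] p).2) := by
  have hac := hab.trans_lt hbc
  induction p with
  | nil => simp [rowInsertWord, rowInsert, hbc, hab.not_gt, hac.not_gt, hac]
  | cons x r ih =>
    obtain ⟨hx, hr⟩ := List.pairwise_cons.1 hp
    rcases le_or_gt x a with hxa | hax
    · rw [rowInsertWord_cons_le (by grind), rowInsertWord_cons_le (by grind)]
      simpa only [List.cons.injEq, true_and] using ih hr
    rcases lt_or_ge c x with hcx | hxc
    · cases r with
      | nil => simp [rowInsertWord, rowInsert, hax, hcx, hbc, hac, hac.not_gt, hab.not_gt]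
      | cons y s =>
        have hxy := hx y List.mem_cons_self
        have hcy := hcx.trans_le hxy
        simp only [rowInsertWord, rowInsert_cons_lt hax, rowInsert_cons_le hac.le,
          rowInsert_cons_le hab, rowInsert_cons_lt hcx, rowInsert_cons_lt hac,
          rowInsert_cons_lt hcy, rowInsert_cons_lt hbc, rowInsert_cons_lt (hbc.trans hcy)]
        exact ⟨trivial, .inr (.inr (.bac_bca hcx hxy))⟩
    · simp only [rowInsertWord, rowInsert_cons_lt hax, rowInsert_cons_le hac.le,
        rowInsert_cons_le hab, rowInsert_cons_le hxc]
      refine ⟨trivial, ?_⟩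
      cases hd : (rowInsert c r).2 with
      | none => exact .inl (by simp)
      | some d =>
        have hmem := mem_rowInsert_self c r
        cases he : (rowInsert b (rowInsert c r).1).2 with
        | none => exact absurd (rowInsert_eq_none_iff.1 he c hmem) hbc.not_ge
        | some e =>
          have hed : e < d := (le_of_rowInsert_eq_some (pairwise_rowInsert hr) he hmem hbc).trans_lt
            (lt_of_rowInsert_eq_some hd)
          have hxe : x ≤ e := by
            rcases eq_or_mem_of_mem_rowInsert (mem_of_rowInsert_eq_some he) with rfl | her
            exacts [hxc, hx e her]
          exact .inr (.inl (.acb_cab hxe hed))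

theorem rowInsertWord_bac_bca {a b c : ℕ} (hab : a < b) (hbc : b ≤ c) {p : List ℕ}
    (hp : p.Pairwise (· ≤ ·)) :
    (rowInsertWord [b, a, c] p).1 = (rowInsertWord [b, c, a] p).1 ∧
      ((rowInsertWord [b, a, c] p).2 = (rowInsertWord [b, c, a] p).2 ∨
        KnuthTriple (rowInsertWord [b, a, c] p).2 (rowInsertWord [b, c, a] p).2) := by
  have hac := hab.trans_le hbc
  induction p with
  | nil => simp [rowInsertWord, rowInsert, hbc.not_gt, hab, hac.not_gt]
  | cons x r ih =>
    obtain ⟨hx, hr⟩ := List.pairwise_cons.1 hp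
    rcases le_or_gt x a with hxa | hax
    · rw [rowInsertWord_cons_le (by grind), rowInsertWord_cons_le (by grind)]
      simpa only [List.cons.injEq, true_and] using ih hr
    rcases lt_or_ge b x with hbx | hxb
    · simp only [rowInsertWord, rowInsert_cons_lt hbx, rowInsert_cons_lt hab,
        rowInsert_cons_le hac.le, rowInsert_cons_le hbc]
      refine ⟨trivial, ?_⟩
      cases hd : (rowInsert c r).2 with
      | none => exact .inl (by simp)
      | some d => exact .inr (.bac_bca hbx (hx d (mem_of_rowInsert_eq_some hd)))
    · simp only [rowInsertWord, rowInsert_cons_le hxb, rowInsert_cons_lt hax,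
        rowInsert_cons_le hac.le, rowInsert_cons_le (hxb.trans hbc)]
      refine ⟨trivial, ?_⟩
      cases he : (rowInsert c (rowInsert b r).1).2 with
      | none => exact .inl (by simp)
      | some e =>
        have hbe := hbc.trans_lt (lt_of_rowInsert_eq_some he)
        have her : e ∈ r :=
          (eq_or_mem_of_mem_rowInsert (mem_of_rowInsert_eq_some he)).resolve_left hbe.ne'
        cases hd : (rowInsert b r).2 with
        | none => exact absurd (rowInsert_eq_none_iff.1 hd e her) hbe.not_ge
        | some d =>
          exact .inr (.bac_bca (hxb.trans_lt (lt_of_rowInsert_eq_some hd))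
            (le_of_rowInsert_eq_some hr hd her hbe))

theorem rowInsertWord_knuthTriple {w w' : List ℕ} (h : KnuthTriple w w') {p : List ℕ}
    (hp : p.Pairwise (· ≤ ·)) :
    (rowInsertWord w p).1 = (rowInsertWord w' p).1 ∧
      ((rowInsertWord w p).2 = (rowInsertWord w' p).2 ∨
        KnuthTriple (rowInsertWord w p).2 (rowInsertWord w' p).2 ∨
        KnuthTriple (rowInsertWord w' p).2 (rowInsertWord w p).2) := by
  cases h with
  | acb_cab hab hbc => exact rowInsertWord_acb_cab hab hbc hp
  | bac_bca hab hbc =>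
    exact (rowInsertWord_bac_bca hab hbc hp).imp_right (Or.imp_right Or.inl)

theorem tabInsertWord_knuthTriple {w w' : List ℕ} (h : KnuthTriple w w') {t : List (List ℕ)}
    (ht : IsTableau t) : tabInsertWord w t = tabInsertWord w' t := by
  induction t generalizing w w' with
  | nil =>
    cases h with
    | @acb_cab a b c hab hbc =>
      simp [tabInsertWord, tabInsert, rowInsert, hbc, hab.not_gt, (hab.trans hbc.le).not_gt,
        hab.trans_lt hbc]
    | @bac_bca a b c hab hbc =>
      simp [tabInsertWord, tabInsert, rowInsert, hbc.not_gt, hab, (hab.le.trans hbc).not_gt]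
  | cons p t ih =>
    obtain ⟨hrow, hbumped⟩ := rowInsertWord_knuthTriple h ht.2.1
    rw [tabInsertWord_cons, tabInsertWord_cons, hrow]
    rcases hbumped with heq | htriple | htriple
    · rw [heq]
    · rw [ih htriple ht.2.2.2]
    · rw [ih htriple ht.2.2.2]

theorem tabInsertWord_append_append {w w' : List ℕ} (h : KnuthTriple w w') (u v : List ℕ) :
    tabInsertWord (u ++ w ++ v) [] = tabInsertWord (u ++ w' ++ v) [] := by
  simp only [tabInsertWord_append]
  exact congrArg _ (tabInsertWord_knuthTriple h (isTableau_tabInsertWord u))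

section Colour

variable {B : Type*} [DecidableEq B]

/-- The word formed by the letters of colour `b` of a word. -/
def colourPart (b : B) (w : List (ℕ × B)) : List ℕ :=
  (w.filter fun x => x.2 = b).map Prod.fst

theorem colourPart_append (b : B) (u v : List (ℕ × B)) :
    colourPart b (u ++ v) = colourPart b u ++ colourPart b v := by simp [colourPart]

theorem coloured_colourPart (b : B) (w : List (ℕ × B)) :
    coloured b (colourPart b w) = w.filter fun x => x.2 = b := by
  rw [coloured, colourPart, List.map_map]
  refine (List.map_congr_left fun x hx => ?_).trans (List.map_id _)
  exact Prod.ext rfl (of_decide_eq_true (List.mem_filter.1 hx).2).symm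

theorem colourPart_coloured (b β : B) (l : List ℕ) :
    colourPart b (coloured β l) = if β = b then l else [] := by
  split_ifs with hβ <;> simp [colourPart, coloured, hβ, List.filter_map, Function.comp_def]

theorem tabInsertWord_colourPart_coloured {l l' : List ℕ} (h : KnuthTriple l l') (b β : B)
    (u v : List (ℕ × B)) :
    tabInsertWord (colourPart b (u ++ coloured β l ++ v)) [] =
      tabInsertWord (colourPart b (u ++ coloured β l' ++ v)) [] := by
  simp only [colourPart_append, colourPart_coloured]
  split_ifs
  exacts [tabInsertWord_append_append h _ _, rfl]

theorem Knuth.tabInsertWord_colourPart {w w' : List (ℕ × B)} (h : Knuth w w') (b : B) :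
    tabInsertWord (colourPart b w) [] = tabInsertWord (colourPart b w') [] := by
  cases h with
  | exchange u v x y h =>
    have hswap : colourPart b [x, y] = colourPart b [y, x] := by
      simp only [colourPart, List.filter_cons, List.filter_nil]
      grind
    simp only [colourPart_append, hswap]
  | acb_cab u v a b c β h h' => exact tabInsertWord_colourPart_coloured (.acb_cab h h') _ _ _ _
  | cab_acb u v a b c β h h' =>
    exact (tabInsertWord_colourPart_coloured (.acb_cab h h') _ _ _ _).symm
  | bac_bca u v a b c β h h' => exact tabInsertWord_colourPart_coloured (.bac_bca h h') _ _ _ _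
  | bca_bac u v a b c β h h' =>
    exact (tabInsertWord_colourPart_coloured (.bac_bca h h') _ _ _ _).symm

theorem knuthEquiv_flatMap_readingWord {bs : List B} {w : List (ℕ × B)} (hbs : bs.Nodup)
    (h : ∀ x ∈ w, x.2 ∈ bs) :
    KnuthEquiv w (bs.flatMap fun b =>
      coloured b (readingWord (tabInsertWord (colourPart b w) []))) := by
  refine (knuthEquiv_flatMap_filter hbs h).trans ?_
  clear hbs h
  induction bs with
  | nil => exact .refl _
  | cons b bs ih =>
    rw [List.flatMap_cons, List.flatMap_cons, ← coloured_colourPart]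
    exact ((knuthEquiv_readingWord b _).append_right _).trans (ih.append_left _)

theorem knuthEquiv_of_tabInsertWord_eq [Finite B] {w w' : List (ℕ × B)}
    (h : ∀ b, tabInsertWord (colourPart b w) [] = tabInsertWord (colourPart b w') []) :
    KnuthEquiv w w' := by
  cases nonempty_fintype B
  have toReadingWord (w : List (ℕ × B)) := knuthEquiv_flatMap_readingWord (w := w)
    (Finset.nodup_toList Finset.univ) fun x _ => Finset.mem_toList.2 (Finset.mem_univ x.2)
  have hw := toReadingWord w
  simp only [h] at hw
  exact hw.trans (toReadingWord w').symm

end Colour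
/-! ### The Robinson-Schensted-Okada correspondence -/

section RSO

variable {B : Type*} {n : ℕ}

@[simp] theorem dual_fst (inv : B → B) (α : Wr B n) (i : Fin n) :
    (dual inv α).1 i = inv (α.1 (α.2 i)) := by simp [dual, leftAct]

@[simp] theorem dual_snd (inv : B → B) (α : Wr B n) : (dual inv α).2 = α.2⁻¹ := by
  simp [dual, leftAct]

theorem dual_dual {inv : B → B} (hinv : Function.Involutive inv) (α : Wr B n) :
    dual inv (dual inv α) = α :=
  Prod.ext (funext fun i => by simp [hinv (α.1 i)]) (by simp)

theorem word_injective : Function.Injective (word : Wr B n → List (ℕ × B)) := by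
  rintro ⟨c, σ⟩ ⟨c', σ'⟩ h
  have hletter := congrFun (List.ofFn_injective h)
  simp only [Prod.mk.injEq, Nat.add_right_cancel_iff] at hletter
  obtain rfl : σ = σ' := Equiv.ext fun i => Fin.ext (hletter i).1
  refine Prod.ext (funext fun i => ?_) rfl
  simpa using (hletter (σ⁻¹ i)).2

theorem map_fst_word (α : Wr B n) :
    (((word α).map Prod.fst : List ℕ) : Multiset ℕ) = (Finset.Icc 1 n).val := by
  have hmap : (word α).map Prod.fst = (List.finRange n).map fun i => (α.2 i : ℕ) + 1 := by
    rw [word, List.map_ofFn, List.ofFn_eq_map, Function.comp_def]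
  rw [hmap]
  refine (Multiset.Nodup.ext ?_ (Finset.nodup _)).2 fun a => ?_
  · exact (List.nodup_finRange _).map fun i j hij => α.2.injective (Fin.ext (by simpa using hij))
  · simp only [Multiset.mem_coe, List.mem_map, List.mem_finRange, true_and, Finset.mem_val,
      Finset.mem_Icc]
    constructor
    · rintro ⟨i, rfl⟩
      have := (α.2 i).2
      omega
    · rintro ⟨hpos, hle⟩
      exact ⟨α.2.symm ⟨a - 1, by omega⟩, by simp; omega⟩

theorem exists_wr_of_injective {a : Fin n → ℕ} (ha : Function.Injective a)
    (hmem : ∀ i, a i ∈ Finset.Icc 1 n) (c : Fin n → B) :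
    ∃ α : Wr B n, ∀ i, (α.2 i : ℕ) + 1 = a i ∧ α.1 (α.2 i) = c i := by
  have hvalue (i : Fin n) : ∃ k : Fin n, (k : ℕ) + 1 = a i := by
    have := Finset.mem_Icc.1 (hmem i)
    exact ⟨⟨a i - 1, by omega⟩, by simp; omega⟩
  choose σ hσ using hvalue
  have hinj : Function.Injective σ := fun i j hij => ha (by rw [← hσ, ← hσ, hij])
  let τ := Equiv.ofBijective σ (Finite.injective_iff_bijective.1 hinj)
  exact ⟨(c ∘ τ.symm, τ), fun i => ⟨hσ i, congrArg c (τ.symm_apply_apply i)⟩⟩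

theorem exists_word_eq {w : List (ℕ × B)}
    (h : ((w.map Prod.fst : List ℕ) : Multiset ℕ) = (Finset.Icc 1 n).val) :
    ∃ α : Wr B n, word α = w := by
  obtain rfl : w.length = n := by simpa using congrArg Multiset.card h
  have hnodup : (w.map Prod.fst).Nodup := Multiset.coe_nodup.1 (h ▸ Finset.nodup _)
  obtain ⟨α, hα⟩ := exists_wr_of_injective (a := fun i => w[i].1)
    (fun i j hij => Fin.ext ((hnodup.getElem_inj_iff (hi := by simp) (hj := by simp)).1
      (by simpa using hij)))
    (fun i => by
      rw [← Finset.mem_val, ← h]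
      exact List.mem_map_of_mem (List.getElem_mem i.2))
    (fun i => w[i].2)
  refine ⟨α, List.ext_getElem (by simp [word]) fun i _ hi => ?_⟩
  simpa [word] using Prod.ext (hα ⟨i, hi⟩).1 (hα ⟨i, hi⟩).2

theorem eq_and_eq_of_nodup_sum_map [Fintype B] {A C : Type*} {w : B → List A} {f : A → C}
    (h : (∑ b, ((w b).map f : Multiset C)).Nodup) {b b' : B} {x x' : A} (hx : x ∈ w b)
    (hx' : x' ∈ w b') (heq : f x = f x') : b = b' ∧ x = x' := by
  let W : Multiset (A × B) := ∑ b, (w b : Multiset A).map fun x => (x, b)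
  have hmem {b : B} {x : A} (hx : x ∈ w b) : (x, b) ∈ W :=
    Multiset.mem_sum.2 ⟨b, Finset.mem_univ b, Multiset.mem_map_of_mem _ hx⟩
  have hmap : W.map (fun y => f y.1) = ∑ b, ((w b).map f : Multiset C) := by
    refine (map_sum (Multiset.mapAddMonoidHom fun y : A × B => f y.1) _ _).trans ?_
    simp [Function.comp_def]
  have hpair := Multiset.inj_on_of_nodup_map (hmap ▸ h) _ (hmem hx) _ (hmem hx') heq
  exact ⟨congrArg Prod.snd hpair, congrArg Prod.fst hpair⟩

variable [DecidableEq B]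

/-- The subword of `w(α)` formed by the letters of colour `b`, as a word in two lines. -/
def twoLine (α : Wr B n) (b : B) : List (ℕ × ℕ) :=
  ((List.finRange n).filter fun i : Fin n => α.1 (α.2 i) = b).map
    fun i : Fin n => ((i : ℕ) + 1, (α.2 i : ℕ) + 1)

theorem rso_eq (α : Wr B n) (b : B) : rso α b = robinsonSchensted (twoLine α b) := rfl

theorem mem_twoLine {α : Wr B n} {b : B} {x : ℕ × ℕ} :
    x ∈ twoLine α b ↔ ∃ i : Fin n, α.1 (α.2 i) = b ∧ x = ((i : ℕ) + 1, (α.2 i : ℕ) + 1) := by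
  simp [twoLine, eq_comm]

theorem map_snd_twoLine (α : Wr B n) (b : B) :
    (twoLine α b).map Prod.snd = colourPart b (word α) := by
  simp only [twoLine, colourPart, word, List.ofFn_eq_map, List.filter_map, List.map_map,
    Function.comp_def]

theorem pairwise_twoLine (α : Wr B n) (b : B) :
    ((twoLine α b).map Prod.fst).Pairwise (· < ·) := by
  rw [twoLine, List.map_map, List.pairwise_map]
  exact (List.pairwise_lt_finRange n).filter _ |>.imp fun h => by simpa using h

theorem nodup_of_pairwise_map_fst {w : List (ℕ × ℕ)} (hw : (w.map Prod.fst).Pairwise (· < ·)) :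
    w.Nodup :=
  (List.pairwise_map.1 hw).imp fun hlt heq => hlt.ne (congrArg _ heq)

theorem eq_of_pairwise_of_mem_iff {w w' : List (ℕ × ℕ)} (hw : (w.map Prod.fst).Pairwise (· < ·))
    (hw' : (w'.map Prod.fst).Pairwise (· < ·)) (h : ∀ x, x ∈ w ↔ x ∈ w') : w = w' :=
  List.Perm.eq_of_pairwise (fun _ _ _ _ hlt hgt => absurd hlt hgt.not_gt)
    (List.pairwise_map.1 hw) (List.pairwise_map.1 hw')
    ((List.perm_ext_iff_of_nodup (nodup_of_pairwise_map_fst hw)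
      (nodup_of_pairwise_map_fst hw')).2 h)

theorem twoLine_injective : Function.Injective (twoLine : Wr B n → B → List (ℕ × ℕ)) := by
  refine fun α β h => word_injective (congrArg List.ofFn (funext fun i => ?_))
  have hmem : ((i : ℕ) + 1, (α.2 i : ℕ) + 1) ∈ twoLine β (α.1 (α.2 i)) := by
    rw [← h, mem_twoLine]
    exact ⟨i, rfl, rfl⟩
  obtain ⟨j, hcolour, hij⟩ := mem_twoLine.1 hmem
  simp only [Prod.mk.injEq, Nat.add_right_cancel_iff] at hij
  obtain rfl := Fin.ext hij.1
  rw [hij.2, hcolour]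

theorem twoLine_dual {inv : B → B} (hinv : Function.Involutive inv) (α : Wr B n) (b : B) :
    (twoLine (dual inv α) b).Perm ((twoLine α (inv b)).map Prod.swap) := by
  rw [List.perm_ext_iff_of_nodup (nodup_of_pairwise_map_fst (pairwise_twoLine _ _))
    ((nodup_of_pairwise_map_fst (pairwise_twoLine _ _)).map Prod.swap_injective)]
  intro x
  simp only [mem_twoLine, List.mem_map, dual_fst, dual_snd]
  constructor
  · rintro ⟨i, hi, rfl⟩
    exact ⟨_, ⟨α.2⁻¹ i, by simpa [← hi] using (hinv _).symm, rfl⟩, by simp⟩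
  · rintro ⟨_, ⟨i, hi, rfl⟩, rfl⟩
    exact ⟨α.2 i, by simp [hi, hinv b], by simp⟩

theorem rso_dual {inv : B → B} (hinv : Function.Involutive inv) (α : Wr B n) (b : B) :
    rso (dual inv α) b = (rso α (inv b)).map Prod.swap :=
  robinsonSchensted_inverse (pairwise_twoLine _ _) (pairwise_twoLine _ _) (twoLine_dual hinv α b)

theorem recordRows_dual {inv : B → B} (hinv : Function.Involutive inv) (α : Wr B n) (b : B) :
    recordRows (dual inv α) b = insertionRows α (inv b) := by
  simp [recordRows, insertionRows, rso_dual hinv, Function.comp_def]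

theorem insertionRows_eq (α : Wr B n) (b : B) :
    insertionRows α b = tabInsertWord (colourPart b (word α)) [] := by
  rw [insertionRows, rso_eq, map_fst_robinsonSchensted, map_snd_twoLine]

theorem Knuth.insertionRows_eq {α β : Wr B n} (h : Knuth (word α) (word β)) :
    insertionRows α = insertionRows β :=
  funext fun b => by rw [FQ.insertionRows_eq, FQ.insertionRows_eq, h.tabInsertWord_colourPart]

theorem knuthEquiv_word [Finite B] {α β : Wr B n} (h : insertionRows α = insertionRows β) :
    KnuthEquiv (word α) (word β) :=
  knuthEquiv_of_tabInsertWord_eq fun b => by rw [← insertionRows_eq, ← insertionRows_eq, h]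

theorem map_length_insertionRows (α : Wr B n) (b : B) :
    (insertionRows α b).map List.length = (recordRows α b).map List.length := by
  rw [insertionRows, recordRows, List.map_map, List.map_map]
  exact List.map_congr_left (sameShape_robinsonSchensted (twoLine α b))

theorem eq_of_rows_eq {α β : Wr B n} (hP : insertionRows α = insertionRows β)
    (hQ : recordRows α = recordRows β) : α = β := by
  refine twoLine_injective (funext fun b => robinsonSchensted_injective (pairwise_twoLine _ _)
    (pairwise_twoLine _ _) ?_)
  have hPb : (rso α b).map Prod.fst = (rso β b).map Prod.fst := congrFun hP b
  have hQb : (rso α b).map Prod.snd = (rso β b).map Prod.snd := congrFun hQ b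
  rw [← rso_eq, ← rso_eq, ← List.zip_unzip (rso α b), ← List.zip_unzip (rso β b)]
  simp only [List.unzip_eq_map, hPb, hQb]

variable [Fintype B]

/-- The families of lists of rows that come from standard `B`-tableaux with `n` boxes. -/
def IsStandardRows (n : ℕ) (R : B → List (List ℕ)) : Prop :=
  (∀ b, IsTableau (R b)) ∧ ∑ b, ((R b).flatten : Multiset ℕ) = (Finset.Icc 1 n).val

theorem sum_colourPart (w : List (ℕ × B)) :
    ∑ b, (colourPart b w : Multiset ℕ) = (w.map Prod.fst : List ℕ) := by
  induction w with
  | nil => simp [colourPart]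
  | cons x w ih =>
    have hcons (b : B) : (colourPart b (x :: w) : Multiset ℕ) =
        (if x.2 = b then {x.1} else 0) + (colourPart b w : Multiset ℕ) := by
      by_cases hb : x.2 = b <;> simp [colourPart, hb]
    simp_rw [hcons]
    rw [Finset.sum_add_distrib, ih]
    simp

theorem isStandardRows_insertionRows (α : Wr B n) : IsStandardRows n (insertionRows α) := by
  refine ⟨fun b => isTableau_map_fst_robinsonSchensted _, ?_⟩
  rw [← map_fst_word α, ← sum_colourPart]
  refine Finset.sum_congr rfl fun b _ => Multiset.coe_eq_coe.2 ?_
  rw [← map_snd_twoLine]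
  exact letters_robinsonSchensted (twoLine α b)

theorem isStandardRows_recordRows (α : Wr B n) : IsStandardRows n (recordRows α) := by
  have hid : Function.Involutive (id : B → B) := fun _ => rfl
  have hdual : recordRows α = insertionRows (dual id α) := funext fun b => by
    simpa only [dual_dual hid, id_eq] using recordRows_dual hid (dual id α) b
  exact hdual ▸ isStandardRows_insertionRows _

theorem exists_twoLine_eq {w : B → List (ℕ × ℕ)}
    (hincr : ∀ b, ((w b).map Prod.fst).Pairwise (· < ·))
    (hlabels : ∑ b, ((w b).map Prod.fst : Multiset ℕ) = (Finset.Icc 1 n).val)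
    (hletters : ∑ b, ((w b).map Prod.snd : Multiset ℕ) = (Finset.Icc 1 n).val) :
    ∃ α : Wr B n, twoLine α = w := by
  have hmem (f : ℕ × ℕ → ℕ) (a : ℕ) :
      a ∈ ∑ b, ((w b).map f : Multiset ℕ) ↔ ∃ b, ∃ x ∈ w b, f x = a := by
    simp [Multiset.mem_sum]
  have hlabel {a : ℕ} : a ∈ Finset.Icc 1 n ↔ ∃ b, ∃ x ∈ w b, x.1 = a := by
    rw [← hmem, hlabels, Finset.mem_val]
  have hletter {b : B} {x : ℕ × ℕ} (hx : x ∈ w b) : x.2 ∈ Finset.Icc 1 n := by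
    rw [← Finset.mem_val, ← hletters, hmem]
    exact ⟨b, x, hx, rfl⟩
  have hchoice (i : Fin n) : ∃ (b : B) (a : ℕ), ((i : ℕ) + 1, a) ∈ w b := by
    obtain ⟨b, ⟨_, a⟩, hx, rfl⟩ := hlabel.1 (Finset.mem_Icc.2 ⟨Nat.succ_pos _, i.2⟩)
    exact ⟨b, a, hx⟩
  choose c a hca using hchoice
  obtain ⟨α, hα⟩ := exists_wr_of_injective (a := a) (fun i j hij => by
    have := (eq_and_eq_of_nodup_sum_map (hletters ▸ Finset.nodup _) (hca i) (hca j) hij).2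
    exact Fin.ext (by simpa using congrArg Prod.fst this)) (fun i => hletter (hca i)) c
  refine ⟨α, funext fun b => eq_of_pairwise_of_mem_iff (pairwise_twoLine _ _) (hincr b)
    fun x => mem_twoLine.trans ⟨?_, fun hx => ?_⟩⟩
  · rintro ⟨i, rfl, rfl⟩
    rw [(hα i).1, (hα i).2]
    exact hca i
  · obtain ⟨hpos, hle⟩ := Finset.mem_Icc.1 (hlabel.2 ⟨b, x, hx, rfl⟩)
    obtain ⟨i, hi⟩ : ∃ i : Fin n, x.1 = i + 1 := ⟨⟨x.1 - 1, by omega⟩, by simp; omega⟩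
    obtain ⟨rfl, rfl⟩ := eq_and_eq_of_nodup_sum_map (hlabels ▸ Finset.nodup _) hx (hca i) hi
    exact ⟨i, (hα i).2, by rw [(hα i).1]⟩

theorem exists_of_isStandardRows {R R' : B → List (List ℕ)} (hR : IsStandardRows n R)
    (hR' : IsStandardRows n R') (h : ∀ b, (R b).map List.length = (R' b).map List.length) :
    ∃ α : Wr B n, insertionRows α = R ∧ recordRows α = R' := by
  have hlen (b : B) : (R b).length = (R' b).length := by simpa using congrArg List.length (h b)
  have hfst (b : B) : ((R b).zip (R' b)).map Prod.fst = R b := List.map_fst_zip (hlen b).le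
  have hsnd (b : B) : ((R b).zip (R' b)).map Prod.snd = R' b := List.map_snd_zip (hlen b).ge
  have hpair (b : B) : IsTableauPair ((R b).zip (R' b)) := by
    refine ⟨(hfst b).symm ▸ hR.1 b, (hsnd b).symm ▸ hR'.1 b, List.map_inj_left.1 ?_⟩
    have hlengths : (((R b).zip (R' b)).map Prod.fst).map List.length =
        (((R b).zip (R' b)).map Prod.snd).map List.length := by rw [hfst, hsnd, h]
    rwa [List.map_map, List.map_map] at hlengths
  have hnodup (b : B) : (labels ((R b).zip (R' b))).Nodup := by
    rw [labels, hsnd, ← Multiset.coe_nodup]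
    exact Multiset.nodup_of_le (Finset.single_le_sum
      (f := fun b => ((R' b).flatten : Multiset ℕ)) (fun _ _ => Multiset.zero_le _)
      (Finset.mem_univ b)) (hR'.2 ▸ Finset.nodup _)
  choose w hincr hrs using fun b => exists_robinsonSchensted_eq (hpair b) (hnodup b)
  have hletters (b : B) : ((w b).map Prod.snd).Perm (R b).flatten := by
    simpa only [hrs, letters, hfst] using (letters_robinsonSchensted (w b)).symm
  have hlabels (b : B) : ((w b).map Prod.fst).Perm (R' b).flatten := by
    simpa only [hrs, labels, hsnd] using (labels_robinsonSchensted (w b)).symm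
  obtain ⟨α, rfl⟩ := exists_twoLine_eq hincr
    ((Finset.sum_congr rfl fun b _ => Multiset.coe_eq_coe.2 (hlabels b)).trans hR'.2)
    ((Finset.sum_congr rfl fun b _ => Multiset.coe_eq_coe.2 (hletters b)).trans hR.2)
  exact ⟨α, funext fun b => by rw [insertionRows, rso_eq, hrs, hfst],
    funext fun b => by rw [recordRows, rso_eq, hrs, hsnd]⟩

end RSO
/-! ### Tableaux and lists of rows -/

theorem dominates_iff {p q : List ℕ} :
    Dominates p q ↔ q.length ≤ p.length ∧ ∀ i, i < q.length → p.getD i 0 < q.getD i 0 := by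
  induction q generalizing p with
  | nil => simp
  | cons y q ih =>
    cases p with
    | nil => simp
    | cons x p =>
      rw [cons_dominates_cons, ih]
      constructor
      · rintro ⟨hxy, hlen, hlt⟩
        refine ⟨by simpa using hlen, fun i hi => ?_⟩
        cases i with
        | zero => simpa using hxy
        | succ i => simpa using hlt i (by simpa using hi)
      · rintro ⟨hlen, hlt⟩
        exact ⟨by simpa using hlt 0 (by simp), by simpa using hlen,
          fun i hi => by simpa using hlt (i + 1) (by simpa using hi)⟩

theorem Dominates.trans {p q r : List ℕ} (h : Dominates p q) (h' : Dominates q r) :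
    Dominates p r := by
  rw [dominates_iff] at *
  exact ⟨h'.1.trans h.1, fun i hi => (h.2 i (hi.trans_le h'.1)).trans (h'.2 i hi)⟩

theorem isTableau_iff {t : List (List ℕ)} :
    IsTableau t ↔ (∀ p ∈ t, p ≠ [] ∧ p.Pairwise (· ≤ ·)) ∧ t.Pairwise Dominates := by
  induction t with
  | nil => simp
  | cons p t ih =>
    rw [isTableau_cons, ih, List.forall_mem_cons, List.pairwise_cons]
    constructor
    · rintro ⟨hne, hp, hhead, hrows, ht⟩
      refine ⟨⟨⟨hne, hp⟩, hrows⟩, fun q hq => ?_, ht⟩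
      cases t with
      | nil => simp at hq
      | cons r t =>
        rcases List.mem_cons.1 hq with rfl | hq
        exacts [hhead, Dominates.trans hhead ((List.pairwise_cons.1 ht).1 q hq)]
    · rintro ⟨⟨⟨hne, hp⟩, hrows⟩, hdom, ht⟩
      refine ⟨hne, hp, ?_, hrows, ht⟩
      cases t with
      | nil => simp
      | cons r t => exact hdom r (by simp)

theorem Tableau.isTableau_rows (T : Tableau) : IsTableau T.rows := by
  rw [isTableau_iff, Tableau.rows]
  constructor
  · intro p hp
    obtain ⟨i, hi, rfl⟩ := List.mem_map.1 hp
    rw [List.mem_range, ← YoungDiagram.mem_iff_lt_colLen, YoungDiagram.mem_iff_lt_rowLen] at hi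
    refine ⟨by simpa using hi.ne', ?_⟩
    rw [List.pairwise_map]
    refine List.Pairwise.imp_of_mem (fun _ hb h => ?_) List.pairwise_lt_range
    exact T.2.row_weak h (YoungDiagram.mem_iff_lt_rowLen.2 (List.mem_range.1 hb))
  · rw [List.pairwise_map]
    refine List.pairwise_lt_range.imp fun {i j} hij => dominates_iff.2 ⟨?_, fun k hk => ?_⟩
    · simpa using T.1.rowLen_anti i j hij.le
    · have hkj : k < T.1.rowLen j := by simpa using hk
      have hki : k < T.1.rowLen i := hkj.trans_le (T.1.rowLen_anti i j hij.le)
      simpa [hkj, hki] using T.2.col_strict hij (YoungDiagram.mem_iff_lt_rowLen.2 hkj)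

theorem Tableau.map_length_rows (T : Tableau) : T.rows.map List.length = T.1.rowLens := by
  simp [Tableau.rows, YoungDiagram.rowLens, Function.comp_def]

theorem coe_flatMap_range_rowLen (μ : YoungDiagram) :
    (((List.range (μ.colLen 0)).flatMap fun i =>
      (List.range (μ.rowLen i)).map fun j => (i, j) : List (ℕ × ℕ)) : Multiset (ℕ × ℕ)) =
      μ.cells.val := by
  refine (Multiset.Nodup.ext ?_ μ.cells.nodup).2 fun ⟨i, j⟩ => ?_
  · rw [Multiset.coe_nodup, List.nodup_flatMap]
    refine ⟨fun i _ => List.nodup_range.map fun _ _ h => (Prod.mk.inj h).2,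
      List.nodup_range.imp fun {i j} hij => ?_⟩
    rw [Function.onFun, List.disjoint_left]
    intro x hx hx'
    obtain ⟨_, _, rfl⟩ := List.mem_map.1 hx
    obtain ⟨_, _, heq⟩ := List.mem_map.1 hx'
    exact hij (Prod.mk.inj heq).1.symm
  · simp only [Multiset.mem_coe, List.mem_flatMap, List.mem_range, List.mem_map, Prod.mk.injEq,
      Finset.mem_val, YoungDiagram.mem_cells]
    constructor
    · rintro ⟨_, _, _, hj, rfl, rfl⟩
      exact YoungDiagram.mem_iff_lt_rowLen.2 hj
    · intro h
      exact ⟨i, YoungDiagram.mem_iff_lt_colLen.1 (μ.up_left_mem le_rfl (Nat.zero_le j) h), j,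
        YoungDiagram.mem_iff_lt_rowLen.1 h, rfl, rfl⟩

theorem Tableau.coe_flatten_rows (T : Tableau) : (T.rows.flatten : Multiset ℕ) = T.weight := by
  rw [Tableau.weight, ← coe_flatMap_range_rowLen, Multiset.map_coe, List.map_flatMap,
    Tableau.rows, List.flatMap_def]
  simp only [List.map_map, Function.comp_def]

theorem Tableau.card_weight (T : Tableau) : Multiset.card T.weight = T.1.card := by
  simp [Tableau.weight, YoungDiagram.card]

section OfRows

variable {t : List (List ℕ)}

theorem IsTableau.sortedGE_map_length (ht : IsTableau t) : (t.map List.length).SortedGE := by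
  refine List.Pairwise.sortedGE (List.pairwise_map.2 ?_)
  exact (isTableau_iff.1 ht).2.imp fun h => (dominates_iff.1 h).1

/-- The shape of a semistandard tableau given as a list of rows. -/
def IsTableau.shape (ht : IsTableau t) : YoungDiagram :=
  YoungDiagram.ofRowLens _ ht.sortedGE_map_length

theorem IsTableau.mem_shape (ht : IsTableau t) {i j : ℕ} :
    (i, j) ∈ ht.shape ↔ ∃ h : i < t.length, j < t[i].length := by
  simp [IsTableau.shape, YoungDiagram.mem_ofRowLens]

theorem IsTableau.colLen_shape (ht : IsTableau t) : ht.shape.colLen 0 = t.length := by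
  rw [← YoungDiagram.length_rowLens, IsTableau.shape, YoungDiagram.rowLens_length_ofRowLens,
    List.length_map]
  rintro _ hlen
  obtain ⟨p, hp, rfl⟩ := List.mem_map.1 hlen
  exact List.length_pos_iff.2 ((isTableau_iff.1 ht).1 p hp).1

theorem IsTableau.rowLen_shape (ht : IsTableau t) {i : ℕ} (hi : i < t.length) :
    ht.shape.rowLen i = t[i].length :=
  (YoungDiagram.rowLen_ofRowLens ⟨i, by simpa using hi⟩).trans (List.getElem_map _)

/-- The tableau with a given list of rows. -/
def IsTableau.toTableau (ht : IsTableau t) : Tableau where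
  fst := ht.shape
  snd :=
    { entry := fun i j => (t.getD i []).getD j 0
      row_weak' := by
        intro i j k hjk hik
        obtain ⟨hi, hk⟩ := ht.mem_shape.1 hik
        have hle := List.pairwise_iff_getElem.1
          ((isTableau_iff.1 ht).1 _ (List.getElem_mem hi)).2 j k (hjk.trans hk) hk hjk
        simpa [hi, hk, hjk.trans hk] using hle
      col_strict' := by
        intro i k j hik hkj
        obtain ⟨hk, hj⟩ := ht.mem_shape.1 hkj
        have hi := hik.trans hk
        have hdom := List.pairwise_iff_getElem.1 (isTableau_iff.1 ht).2 i k hi hk hik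
        rw [List.getD_eq_getElem _ _ hi, List.getD_eq_getElem _ _ hk]
        exact (dominates_iff.1 hdom).2 j hj
      zeros' := by
        intro i j hij
        rw [ht.mem_shape] at hij
        by_cases hi : i < t.length
        · have hj : t[i].length ≤ j := not_lt.1 fun h => hij ⟨hi, h⟩
          simp [hi, hj]
        · simp [not_lt.1 hi] }

theorem IsTableau.rows_toTableau (ht : IsTableau t) : ht.toTableau.rows = t := by
  refine List.ext_getElem (by simp [Tableau.rows, IsTableau.toTableau, ht.colLen_shape])
    fun i _ hi => ?_
  refine List.ext_getElem
    (by simp [Tableau.rows, IsTableau.toTableau, ht.rowLen_shape hi]) fun j _ hj => ?_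
  simp only [Tableau.rows, List.getElem_map, List.getElem_range]
  change (t.getD i []).getD j 0 = _
  simp [hi, hj]

end OfRows

section BTableau

variable {B : Type*}

theorem BTableau.shape_eq_iff {T T' : BTableau B} : T.shape = T'.shape ↔
    ∀ b, (T b).rows.map List.length = (T' b).rows.map List.length := by
  simp only [Tableau.map_length_rows, funext_iff, BTableau.shape]
  exact forall_congr' fun b => ⟨fun h => by rw [h], fun h =>
    YoungDiagram.equivListRowLens.injective (Subtype.ext h)⟩

variable [Fintype B]

theorem BTableau.sum_flatten_rows (T : BTableau B) :
    ∑ b, ((T b).rows.flatten : Multiset ℕ) = ∑ b, (T b).weight :=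
  Finset.sum_congr rfl fun b _ => (T b).coe_flatten_rows

theorem BTableau.IsStandard.isStandardRows {T : BTableau B} (h : T.IsStandard) :
    IsStandardRows T.size fun b => (T b).rows :=
  ⟨fun b => (T b).isTableau_rows, T.sum_flatten_rows.trans h⟩

theorem IsStandardRows.exists_isStandard {n : ℕ} {R : B → List (List ℕ)}
    (h : IsStandardRows n R) :
    ∃ T : BTableau B, T.IsStandard ∧ T.size = n ∧ (fun b => (T b).rows) = R := by
  let T : BTableau B := fun b => (h.1 b).toTableau
  have hrows (b : B) : (T b).rows = R b := (h.1 b).rows_toTableau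
  have hweight : ∑ b, (T b).weight = (Finset.Icc 1 n).val := by
    rw [← h.2, ← BTableau.sum_flatten_rows]
    simp only [hrows]
  have hsize : T.size = n := by
    simpa [Multiset.card_sum, Tableau.card_weight, BTableau.size, BTableau.shape]
      using congrArg Multiset.card hweight
  exact ⟨T, by rw [BTableau.IsStandard, hweight, hsize], hsize, funext hrows⟩

end BTableau
/-! ### Sums over fibers in free modules -/

section Fibers

variable {K : Type*} [CommRing K] {S X Y : Type*}

theorem mem_span_of_mapDomain_eq_zero (g : S → X) {x : S →₀ K} (hx : x.mapDomain g = 0) :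
    x ∈ Submodule.span K {y | ∃ s ∈ x.support, ∃ s', g s = g s' ∧
      y = Finsupp.single s (1 : K) - Finsupp.single s' 1} := by
  rcases isEmpty_or_nonempty S with hS | hS
  · rw [Subsingleton.elim x 0]
    exact zero_mem _
  have hsum : ∑ s ∈ x.support, Finsupp.single (Function.invFun g (g s)) (x s) = 0 := by
    rw [← Finsupp.mapDomain_zero (f := Function.invFun g), ← hx, ← Finsupp.mapDomain_comp]
    rfl
  have hx_eq : x = ∑ s ∈ x.support, x s •
      (Finsupp.single s (1 : K) - Finsupp.single (Function.invFun g (g s)) 1) := by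
    simp only [smul_sub, Finset.sum_sub_distrib, Finsupp.smul_single, smul_eq_mul, mul_one]
    rw [hsum, sub_zero]
    exact (Finsupp.sum_single x).symm
  rw [hx_eq]
  refine Submodule.sum_mem _ fun s hs => Submodule.smul_mem _ _ (Submodule.subset_span ?_)
  exact ⟨s, hx_eq ▸ hs, _, (Function.invFun_eq ⟨s, rfl⟩).symm, rfl⟩

theorem single_sub_single_mem_ker (g : S → X) {s s' : S} (h : g s = g s') :
    Finsupp.single s (1 : K) - Finsupp.single s' 1 ∈ LinearMap.ker (Finsupp.lmapDomain K K g) := by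
  rw [LinearMap.mem_ker, map_sub]
  simp [Finsupp.lmapDomain_apply, h]

theorem ker_lmapDomain_eq_span (g : S → X) :
    LinearMap.ker (Finsupp.lmapDomain K K g) = Submodule.span K
      {y | ∃ s s', g s = g s' ∧ y = Finsupp.single s (1 : K) - Finsupp.single s' 1} := by
  refine le_antisymm (fun x hx => ?_) (Submodule.span_le.2 ?_)
  · refine Submodule.span_mono ?_ (mem_span_of_mapDomain_eq_zero g hx)
    rintro _ ⟨s, -, s', hs, rfl⟩
    exact ⟨s, s', hs, rfl⟩
  · rintro _ ⟨s, s', hs, rfl⟩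
    exact single_sub_single_mem_ker g hs

variable {f g : S → X} {sh : X → Y} (hf : ∀ k, (f ⁻¹' {k}).Finite)

/-- The sum of the elements of a finite fiber. -/
noncomputable def fiberSum (K : Type*) [CommRing K] (hf : ∀ k, (f ⁻¹' {k}).Finite) (k : X) :
    S →₀ K :=
  ∑ s ∈ (hf k).toFinset, Finsupp.single s 1

open scoped Classical in
theorem fiberSum_apply (k : X) (s : S) : fiberSum K hf k s = if f s = k then 1 else 0 := by
  simp [fiberSum, Finsupp.finsetSum_apply, Finsupp.single_apply]

/-- The linear map that sends a basis element to the sum of the elements of its fiber. -/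
noncomputable def fiberSums (K : Type*) [CommRing K] (hf : ∀ k, (f ⁻¹' {k}).Finite) :
    (X →₀ K) →ₗ[K] (S →₀ K) :=
  Finsupp.linearCombination K (fiberSum K hf)

theorem fiberSums_single (k : X) : fiberSums K hf (Finsupp.single k 1) = fiberSum K hf k := by
  simp [fiberSums]

theorem fiberSums_apply (y : X →₀ K) (s : S) : fiberSums K hf y s = y (f s) := by
  classical
  induction y using Finsupp.induction_linear with
  | zero => simp
  | add y z hy hz => simp [hy, hz]
  | single k a => simp [fiberSums, fiberSum_apply, Finsupp.single_apply, eq_comm]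

theorem range_fiberSums :
    LinearMap.range (fiberSums K hf) = Submodule.span K (Set.range (fiberSum K hf)) :=
  Finsupp.range_linearCombination K

section Surjective

variable (hsurj : Function.Surjective f)

/-- The restriction of functions on `S` to a section of `f`, a retraction of `fiberSums`. -/
noncomputable def restrictSection (K : Type*) [CommRing K] (hsurj : Function.Surjective f) :
    (S →₀ K) →ₗ[K] (X →₀ K) :=
  Finsupp.lcomapDomain (Function.surjInv hsurj) (Function.injective_surjInv hsurj)

theorem restrictSection_fiberSums (y : X →₀ K) :
    restrictSection K hsurj (fiberSums K hf y) = y := by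
  ext k
  rw [restrictSection, Finsupp.lcomapDomain_apply, Finsupp.comapDomain_apply, fiberSums_apply,
    Function.surjInv_eq hsurj]

include hsurj in
theorem fiberSums_injective : Function.Injective (fiberSums K hf) :=
  Function.LeftInverse.injective (restrictSection_fiberSums hf hsurj)

theorem fiberSums_restrictSection {x : S →₀ K} (hx : ∀ s s', f s = f s' → x s = x s') :
    fiberSums K hf (restrictSection K hsurj x) = x := by
  ext s
  rw [fiberSums_apply, restrictSection, Finsupp.lcomapDomain_apply, Finsupp.comapDomain_apply]
  exact hx _ _ (Function.surjInv_eq hsurj (f s))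

include hsurj in
theorem mem_range_fiberSums {x : S →₀ K} :
    x ∈ LinearMap.range (fiberSums K hf) ↔ ∀ s s', f s = f s' → x s = x s' := by
  refine ⟨?_, fun h => ⟨_, fiberSums_restrictSection hf hsurj h⟩⟩
  rintro ⟨y, rfl⟩ s s' h
  rw [fiberSums_apply, fiberSums_apply, h]

include hsurj in
theorem mem_range_map_range_fiberSums {z : (S →₀ K) ⊗[K] (S →₀ K)}
    (hz : ∀ s s' t t', f s = f s' → f t = f t' →
      finsuppTensorFinsupp' K S S z (s, t) = finsuppTensorFinsupp' K S S z (s', t')) :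
    z ∈ LinearMap.range (TensorProduct.map (LinearMap.range (fiberSums K hf)).subtype
      (LinearMap.range (fiberSums K hf)).subtype) := by
  set e : (S →₀ K) →ₗ[K] (S →₀ K) := fiberSums K hf ∘ₗ restrictSection K hsurj with he
  have he_apply (x : S →₀ K) (s : S) : e x s = x (Function.surjInv hsurj (f s)) :=
    fiberSums_apply hf _ s
  have hcoord (w : (S →₀ K) ⊗[K] (S →₀ K)) (s t : S) :
      finsuppTensorFinsupp' K S S (TensorProduct.map e e w) (s, t) =
        finsuppTensorFinsupp' K S S w
          (Function.surjInv hsurj (f s), Function.surjInv hsurj (f t)) := by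
    induction w using TensorProduct.induction_on with
    | zero => simp
    | tmul x y => simp [he_apply]
    | add x y hx hy => simp only [map_add, Finsupp.add_apply, hx, hy]
  have hfix : TensorProduct.map e e z = z := by
    refine (finsuppTensorFinsupp' K S S).injective (Finsupp.ext fun ⟨s, t⟩ => ?_)
    rw [hcoord]
    exact hz _ _ _ _ (Function.surjInv_eq hsurj _) (Function.surjInv_eq hsurj _)
  rw [TensorProduct.range_map, Submodule.range_subtype, ← TensorProduct.range_map, ← hfix, he,
    TensorProduct.map_comp]
  exact LinearMap.mem_range_self _ _

theorem isCompl_range_fiberSums :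
    IsCompl (LinearMap.range (fiberSums K hf)) (LinearMap.ker (restrictSection K hsurj)) := by
  refine ⟨Submodule.disjoint_def.2 ?_, codisjoint_iff.2 (eq_top_iff.2 fun x _ => ?_)⟩
  · rintro _ ⟨y, rfl⟩ hy
    rw [LinearMap.mem_ker, restrictSection_fiberSums] at hy
    rw [hy, map_zero]
  · refine Submodule.mem_sup.2 ⟨fiberSums K hf (restrictSection K hsurj x), ⟨_, rfl⟩,
      x - fiberSums K hf (restrictSection K hsurj x), ?_, add_sub_cancel _ _⟩
    rw [LinearMap.mem_ker, map_sub, restrictSection_fiberSums, sub_self]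

end Surjective

theorem isCompl_comap_map {V W : Type*} [AddCommGroup V] [Module K V] [AddCommGroup W] [Module K W]
    {M : V →ₗ[K] W} {L : W →ₗ[K] V} (hML : ∀ y, M (L y) = y) {p q : Submodule K W}
    (h : IsCompl p q) : IsCompl (p.comap M) (q.map L) := by
  refine ⟨Submodule.disjoint_def.2 ?_, codisjoint_iff.2 (eq_top_iff.2 fun x _ => ?_)⟩
  · rintro _ hp ⟨y, hq, rfl⟩
    rw [Submodule.mem_comap, hML] at hp
    rw [Submodule.disjoint_def.1 h.disjoint y hp hq, map_zero]
  · obtain ⟨y, hy, z, hz, hyz⟩ := Submodule.mem_sup.1 (h.sup_eq_top ▸ Submodule.mem_top (x := M x))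
    refine Submodule.mem_sup.2 ⟨x - L z, ?_, L z, Submodule.mem_map_of_mem hz, sub_add_cancel _ _⟩
    rwa [Submodule.mem_comap, map_sub, hML, ← hyz, add_sub_cancel_right]

/-- The elements of the set `S` correspond bijectively to the pairs of elements of `X` with the same
image in `Y`. -/
structure IsPairing (f g : S → X) (sh : X → Y) : Prop where
  eq : ∀ s, sh (g s) = sh (f s)
  exists_eq : ∀ k k', sh k = sh k' → ∃ s, g s = k ∧ f s = k'
  unique : ∀ s s', g s = g s' → f s = f s' → s = s'

namespace IsPairing

theorem surjective_left (h : IsPairing f g sh) : Function.Surjective f := fun k =>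
  (h.exists_eq k k rfl).imp fun _ hs => hs.2

theorem surjective_right (h : IsPairing f g sh) : Function.Surjective g := fun k =>
  (h.exists_eq k k rfl).imp fun _ hs => hs.1

theorem rangeFactorization (h : IsPairing f g sh) :
    IsPairing f g (Set.rangeFactorization sh) where
  eq s := Subtype.ext (h.eq s)
  exists_eq k k' hk := h.exists_eq k k' (congrArg Subtype.val hk)
  unique := h.unique

include hf in
theorem finite_fiber (h : IsPairing f g sh) (hsh : Function.Surjective sh) (z : Y) :
    (sh ⁻¹' {z}).Finite := by
  obtain ⟨k, rfl⟩ := hsh z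
  refine ((hf k).image g).subset fun l hl => ?_
  obtain ⟨s, hg, hs⟩ := h.exists_eq l k hl
  exact ⟨s, hs, hg⟩

theorem lmapDomain_fiberSums (h : IsPairing f g sh) (hsh : ∀ z, (sh ⁻¹' {z}).Finite)
    (y : X →₀ K) :
    Finsupp.lmapDomain K K g (fiberSums K hf y) =
      fiberSums K hsh (Finsupp.lmapDomain K K sh y) := by
  classical
  induction y using Finsupp.induction_linear with
  | zero => simp only [map_zero]
  | add y z hy hz => simp only [map_add, hy, hz]
  | single k a =>
    rw [← mul_one a, ← smul_eq_mul, ← Finsupp.smul_single]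
    simp only [map_smul, fiberSums_single, Finsupp.lmapDomain_apply, Finsupp.mapDomain_single,
      fiberSum, Finsupp.mapDomain_finsetSum]
    congr 1
    refine Finset.sum_bij (fun s _ => g s) (fun s hs => ?_) (fun s hs s' hs' hg => ?_)
      (fun l hl => ?_) (fun _ _ => rfl)
    · simp_all [h.eq s]
    · exact h.unique s s' hg (by simp_all)
    · obtain ⟨s, hg, hs⟩ := h.exists_eq l k (by simpa using hl)
      exact ⟨s, by simpa using hs, hg⟩

theorem range_inf_ker (h : IsPairing f g sh) :
    LinearMap.range (fiberSums K hf) ⊓ LinearMap.ker (Finsupp.lmapDomain K K g) =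
      Submodule.span K {x | ∃ k k', sh k = sh k' ∧ x = fiberSum K hf k - fiberSum K hf k'} := by
  have hsh := h.rangeFactorization.finite_fiber hf Set.rangeFactorization_surjective
  have hcomap : (LinearMap.ker (Finsupp.lmapDomain K K g)).comap (fiberSums K hf) =
      LinearMap.ker (Finsupp.lmapDomain K K (Set.rangeFactorization sh)) := by
    ext y
    rw [Submodule.mem_comap, LinearMap.mem_ker, LinearMap.mem_ker,
      h.rangeFactorization.lmapDomain_fiberSums hf hsh,
      map_eq_zero_iff _ (fiberSums_injective hsh Set.rangeFactorization_surjective)]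
  rw [← Submodule.map_comap_eq, hcomap, ker_lmapDomain_eq_span, Submodule.map_span]
  congr 1
  ext x
  constructor
  · rintro ⟨_, ⟨k, k', hk, rfl⟩, rfl⟩
    exact ⟨k, k', congrArg Subtype.val hk, by simp only [map_sub, fiberSums_single]⟩
  · rintro ⟨k, k', hk, rfl⟩
    exact ⟨_, ⟨k, k', Subtype.ext hk, rfl⟩, by simp only [map_sub, fiberSums_single]⟩

-- The sum is the preimage, under the split epimorphism induced by `g`, of the module of the sums
-- over the fibers of `sh`, which has a complement.
theorem exists_isCompl (h : IsPairing f g sh) :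
    ∃ C : Submodule K (S →₀ K), IsCompl
      (LinearMap.range (fiberSums K hf) ⊔ LinearMap.ker (Finsupp.lmapDomain K K g)) C := by
  have hsurj : Function.Surjective (Set.rangeFactorization sh) := Set.rangeFactorization_surjective
  have hsh := h.rangeFactorization.finite_fiber hf hsurj
  have hcomp : Finsupp.lmapDomain K K g ∘ₗ fiberSums K hf =
      fiberSums K hsh ∘ₗ Finsupp.lmapDomain K K (Set.rangeFactorization sh) :=
    LinearMap.ext (h.rangeFactorization.lmapDomain_fiberSums hf hsh)
  have hrange : LinearMap.range (Finsupp.lmapDomain K K (Set.rangeFactorization sh)) = ⊤ :=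
    LinearMap.range_eq_top.2 (Finsupp.mapDomain_surjective hsurj)
  rw [← Submodule.comap_map_eq, ← LinearMap.range_comp, hcomp,
    LinearMap.range_comp_of_range_eq_top _ hrange]
  refine ⟨_, isCompl_comap_map (L := Finsupp.lmapDomain K K (Function.surjInv h.surjective_right))
    (fun y => ?_) (isCompl_range_fiberSums hsh hsurj)⟩
  simp only [Finsupp.lmapDomain_apply]
  rw [← Finsupp.mapDomain_comp, (Function.rightInverse_surjInv h.surjective_right).id,
    Finsupp.mapDomain_id]

end IsPairing

end Fibers

/-! ### Words, products and coproducts -/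

section Words

variable {B : Type*}

theorem Knuth.map {w w' : List (ℕ × B)} (h : Knuth w w') {φ : ℕ → ℕ}
    (hφ : ∀ x ∈ w, ∀ y ∈ w, x.1 < y.1 → φ x.1 < φ y.1) :
    Knuth (w.map (Prod.map φ id)) (w'.map (Prod.map φ id)) := by
  have hφ_le : ∀ x ∈ w, ∀ y ∈ w, x.1 ≤ y.1 → φ x.1 ≤ φ y.1 := fun x hx y hy hxy =>
    hxy.lt_or_eq.elim (fun hlt => (hφ x hx y hy hlt).le) fun heq => by rw [heq]
  cases h with
  | exchange u v x y h =>
    simp only [List.map_append, List.map_cons, List.map_nil]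
    exact .exchange _ _ _ _ h
  | acb_cab u v a b c β hab hbc =>
    simp only [List.map_append, List.map_cons, List.map_nil, Prod.map, id]
    exact .acb_cab _ _ _ _ _ β (hφ_le (a, β) (by simp) (b, β) (by simp) hab)
      (hφ (b, β) (by simp) (c, β) (by simp) hbc)
  | cab_acb u v a b c β hab hbc =>
    simp only [List.map_append, List.map_cons, List.map_nil, Prod.map, id]
    exact .cab_acb _ _ _ _ _ β (hφ_le (a, β) (by simp) (b, β) (by simp) hab)
      (hφ (b, β) (by simp) (c, β) (by simp) hbc)
  | bac_bca u v a b c β hab hbc =>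
    simp only [List.map_append, List.map_cons, List.map_nil, Prod.map, id]
    exact .bac_bca _ _ _ _ _ β (hφ (a, β) (by simp) (b, β) (by simp) hab)
      (hφ_le (b, β) (by simp) (c, β) (by simp) hbc)
  | bca_bac u v a b c β hab hbc =>
    simp only [List.map_append, List.map_cons, List.map_nil, Prod.map, id]
    exact .bca_bac _ _ _ _ _ β (hφ (a, β) (by simp) (b, β) (by simp) hab)
      (hφ_le (b, β) (by simp) (c, β) (by simp) hbc)

theorem Knuth.rec_of_symm {P : List (ℕ × B) → List (ℕ × B) → Prop}
    (symm : ∀ {w w'}, P w w' → P w' w)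
    (exchange : ∀ u v x y, x.2 ≠ y.2 → P (u ++ [x, y] ++ v) (u ++ [y, x] ++ v))
    (acb_cab : ∀ u v a b c β, a ≤ b → b < c →
      P (u ++ [(a, β), (c, β), (b, β)] ++ v) (u ++ [(c, β), (a, β), (b, β)] ++ v))
    (bac_bca : ∀ u v a b c β, a < b → b ≤ c →
      P (u ++ [(b, β), (a, β), (c, β)] ++ v) (u ++ [(b, β), (c, β), (a, β)] ++ v))
    {w w' : List (ℕ × B)} (h : Knuth w w') : P w w' := by
  cases h with
  | exchange u v x y h => exact exchange u v x y h
  | acb_cab u v a b c β hab hbc => exact acb_cab u v a b c β hab hbc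
  | cab_acb u v a b c β hab hbc => exact symm (acb_cab u v a b c β hab hbc)
  | bac_bca u v a b c β hab hbc => exact bac_bca u v a b c β hab hbc
  | bca_bac u v a b c β hab hbc => exact symm (bac_bca u v a b c β hab hbc)

theorem filter_append_swap {A : Type*} {p : A → Bool} {x y : A} (h : ¬(p x ∧ p y))
    (u v : List A) : (u ++ x :: y :: v).filter p = (u ++ y :: x :: v).filter p := by
  cases hx : p x <;> cases hy : p y <;> simp_all

theorem Knuth.filter {p : ℕ → Bool} (hp : ∀ a b c, a ≤ b → b ≤ c → p a → p c → p b)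
    {w w' : List (ℕ × B)} (h : Knuth w w') :
    w.filter (fun x => p x.1) = w'.filter (fun x => p x.1) ∨
      Knuth (w.filter fun x => p x.1) (w'.filter fun x => p x.1) := by
  let q : ℕ × B → Bool := fun x => p x.1
  refine h.rec_of_symm
    (P := fun w w' => w.filter q = w'.filter q ∨ Knuth (w.filter q) (w'.filter q))
    (fun hP => hP.imp Eq.symm Knuth.symm) (fun u v x y hxy => ?_) (fun u v a b c β hab hbc => ?_)
    (fun u v a b c β hab hbc => ?_)
  · by_cases hpxy : p x.1 ∧ p y.1
    · right
      simpa [q, List.filter_cons, hpxy.1, hpxy.2] using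
        Knuth.exchange (u.filter q) (v.filter q) x y hxy
    · left
      simpa using filter_append_swap (p := q) hpxy u v
  · by_cases hpac : p a ∧ p c
    · right
      simpa [q, List.filter_cons, hpac.1, hpac.2, hp a b c hab hbc.le hpac.1 hpac.2] using
        Knuth.acb_cab (u.filter q) (v.filter q) a b c β hab hbc
    · left
      simpa using filter_append_swap (p := q) (x := (a, β)) (y := (c, β)) hpac u ((b, β) :: v)
  · by_cases hpac : p a ∧ p c
    · right
      simpa [q, List.filter_cons, hpac.1, hpac.2, hp a b c hab.le hbc hpac.1 hpac.2] using
        Knuth.bac_bca (u.filter q) (v.filter q) a b c β hab hbc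
    · left
      simpa using filter_append_swap (p := q) (x := (a, β)) (y := (c, β)) hpac (u ++ [(b, β)]) v

@[simp] theorem permProd_castAdd {n m : ℕ} (σ : Equiv.Perm (Fin n)) (σ' : Equiv.Perm (Fin m))
    (i : Fin n) : permProd σ σ' (Fin.castAdd m i) = Fin.castAdd m (σ i) := by
  simp [permProd, Equiv.permCongr_apply]

@[simp] theorem permProd_natAdd {n m : ℕ} (σ : Equiv.Perm (Fin n)) (σ' : Equiv.Perm (Fin m))
    (i : Fin m) : permProd σ σ' (Fin.natAdd n i) = Fin.natAdd n (σ' i) := by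
  simp [permProd, Equiv.permCongr_apply]

/-- The map induced by `f` on the letters of words, which are numbered from `1`; the letters that do
not come from an element of `Fin n` are sent to `0`. -/
def shiftMap {n N : ℕ} (f : Fin n → Fin N) (v : ℕ) : ℕ :=
  if h : v - 1 < n then f ⟨v - 1, h⟩ + 1 else 0

@[simp] theorem shiftMap_apply {n N : ℕ} (f : Fin n → Fin N) (i : Fin n) :
    shiftMap f ((i : ℕ) + 1) = f i + 1 := by simp [shiftMap]

theorem word_leftAct_concat {n m : ℕ} (ρ : Equiv.Perm (Fin (n + m))) (α : Wr B n) (β : Wr B m) :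
    word (leftAct ρ (concat α β)) =
      (word α).map (Prod.map (shiftMap fun i => ρ (Fin.castAdd m i)) id) ++
        (word β).map (Prod.map (shiftMap fun i => ρ (Fin.natAdd n i)) id) := by
  simp only [word, List.ofFn_add, List.map_ofFn]
  congr 2
  · funext i
    change (((ρ * permProd α.2 β.2) (Fin.castAdd m i) : ℕ) + 1,
      Fin.append α.1 β.1 (ρ⁻¹ ((ρ * permProd α.2 β.2) (Fin.castAdd m i)))) = _
    simp
  · funext i
    simp [leftAct, concat]

theorem exists_fin_of_mem_word {n : ℕ} {α : Wr B n} {x : ℕ × B} (h : x ∈ word α) :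
    ∃ i : Fin n, x.1 = i + 1 := by
  obtain ⟨i, rfl⟩ := (List.mem_ofFn' _ _).1 h
  exact ⟨α.2 i, rfl⟩

theorem Knuth.map_shiftMap {n N : ℕ} {α α' : Wr B n} (h : Knuth (word α) (word α'))
    {f : Fin n → Fin N} (hf : StrictMono f) :
    Knuth ((word α).map (Prod.map (shiftMap f) id)) ((word α').map (Prod.map (shiftMap f) id)) := by
  refine h.map fun x hx y hy hxy => ?_
  obtain ⟨i, hi⟩ := exists_fin_of_mem_word hx
  obtain ⟨j, hj⟩ := exists_fin_of_mem_word hy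
  rw [hi, hj, Nat.add_lt_add_iff_right] at hxy
  rw [hi, hj, shiftMap_apply, shiftMap_apply, Nat.add_lt_add_iff_right]
  exact hf hxy

theorem mem_shuffles_iff {n m : ℕ} {ρ : Equiv.Perm (Fin (n + m))} :
    ρ ∈ shuffles n m ↔
      StrictMono (fun i => ρ (Fin.castAdd m i)) ∧ StrictMono fun i => ρ (Fin.natAdd n i) := by
  simp [shuffles, StrictMono]

theorem Knuth.leftAct_concat_left {n m : ℕ} {ρ : Equiv.Perm (Fin (n + m))} (hρ : ρ ∈ shuffles n m)
    {α α' : Wr B n} (h : Knuth (word α) (word α')) (β : Wr B m) :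
    Knuth (word (leftAct ρ (concat α β))) (word (leftAct ρ (concat α' β))) := by
  rw [word_leftAct_concat, word_leftAct_concat]
  simpa using (h.map_shiftMap (mem_shuffles_iff.1 hρ).1).append_append [] _

theorem Knuth.leftAct_concat_right {n m : ℕ} {ρ : Equiv.Perm (Fin (n + m))}
    (hρ : ρ ∈ shuffles n m) (α : Wr B n) {β β' : Wr B m} (h : Knuth (word β) (word β')) :
    Knuth (word (leftAct ρ (concat α β))) (word (leftAct ρ (concat α β'))) := by
  rw [word_leftAct_concat, word_leftAct_concat]
  simpa using (h.map_shiftMap (mem_shuffles_iff.1 hρ).2).append_append _ []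

theorem sort_eq_of_strictMono {A : Type*} [LinearOrder A] {n : ℕ} {w : Fin n → A}
    {π : Equiv.Perm (Fin n)} (h : StrictMono (w ∘ π)) : Tuple.sort w = π :=
  (Tuple.eq_sort_iff.2 ⟨h.monotone, fun _ _ hij heq => absurd heq (h hij).ne⟩).symm

theorem strictMono_comp_sort {A : Type*} [LinearOrder A] {n : ℕ} {w : Fin n → A}
    (h : Function.Injective w) : StrictMono (w ∘ Tuple.sort w) :=
  (Tuple.monotone_sort w).strictMono_of_injective (h.comp (Tuple.sort w).injective)

/-- The standardization of the part of `α` formed by the letters with values in the image of `e`. -/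
def subPart {n k : ℕ} (α : Wr B n) (e : Fin k → Fin n) : Wr B k :=
  (fun i => α.1 (e i), Tuple.sort fun i => α.2⁻¹ (e i))

theorem headPart_eq {n : ℕ} (α : Wr B n) (k : Fin (n + 1)) :
    headPart α k = subPart α fun i => ⟨i, by omega⟩ := by
  simp [headPart, subPart, standardization]

theorem tailPart_eq {n : ℕ} (α : Wr B n) (k : Fin (n + 1)) :
    tailPart α k = subPart α fun i => ⟨k + i, by omega⟩ := by
  simp [tailPart, subPart, standardization]

theorem filter_finRange_eq_ofFn {n k : ℕ} {p : Fin n → Bool} {g : Fin k → Fin n}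
    (hg : StrictMono g) (hp : ∀ i, p i ↔ i ∈ Set.range g) :
    (List.finRange n).filter p = List.ofFn g := by
  refine List.Perm.eq_of_pairwise (le := (· < ·)) (fun _ _ _ _ hlt hgt => absurd hlt hgt.not_gt)
    ((List.pairwise_lt_finRange n).filter _) (List.pairwise_ofFn.2 fun i j hij => hg hij) ?_
  refine (List.perm_ext_iff_of_nodup ((List.nodup_finRange n).filter _)
    (List.nodup_ofFn.2 hg.injective)).2 fun i => ?_
  simp only [List.mem_filter, List.mem_finRange, true_and, hp, List.mem_ofFn']

theorem word_subPart {n k : ℕ} (α : Wr B n) {e : Fin k → Fin n} (he : Function.Injective e)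
    {p : ℕ → Bool} (hp : ∀ v : Fin n, p (v + 1) ↔ v ∈ Set.range e) {φ : ℕ → ℕ}
    (hφ : ∀ i, φ (e i + 1) = i + 1) :
    word (subPart α e) = ((word α).filter fun x => p x.1).map (Prod.map φ id) := by
  set π := Tuple.sort fun i => α.2⁻¹ (e i) with hπ
  have hmono : StrictMono fun i => α.2⁻¹ (e (π i)) :=
    strictMono_comp_sort (α.2⁻¹.injective.comp he)
  have hrange (i : Fin n) : p (α.2 i + 1) ↔ i ∈ Set.range fun i => α.2⁻¹ (e (π i)) := by
    rw [hp]
    constructor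
    · rintro ⟨j, hj⟩
      exact ⟨π⁻¹ j, by simp [hj]⟩
    · rintro ⟨j, rfl⟩
      exact ⟨π j, by simp⟩
  have hfilter : (word α).filter (fun x => p x.1) = (List.ofFn fun i => α.2⁻¹ (e (π i))).map
      fun i => ((α.2 i : ℕ) + 1, α.1 (α.2 i)) := by
    rw [← filter_finRange_eq_ofFn hmono hrange, word, List.ofFn_eq_map, List.filter_map]
    rfl
  rw [hfilter, List.map_ofFn, List.map_ofFn]
  refine congrArg List.ofFn (funext fun i => ?_)
  rw [subPart, ← hπ]
  simp [hφ]

theorem word_headPart {n : ℕ} (α : Wr B n) (k : Fin (n + 1)) :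
    word (headPart α k) = (word α).filter fun x => decide (x.1 ≤ (k : ℕ)) := by
  rw [headPart_eq, word_subPart α (p := fun v => decide (v ≤ (k : ℕ))) (φ := id)]
  · simp
  · exact fun i j h => Fin.ext (by simpa using h)
  · intro v
    simp only [decide_eq_true_eq, Set.mem_range]
    exact ⟨fun h => ⟨⟨v, by omega⟩, rfl⟩, fun ⟨i, hi⟩ => by rw [← hi]; exact i.2⟩
  · exact fun i => rfl

theorem word_tailPart {n : ℕ} (α : Wr B n) (k : Fin (n + 1)) :
    word (tailPart α k) = ((word α).filter fun x => decide ((k : ℕ) < x.1)).map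
      (Prod.map (fun v => v - (k : ℕ)) id) := by
  rw [tailPart_eq, word_subPart α (p := fun v => decide ((k : ℕ) < v)) (φ := fun v => v - (k : ℕ))]
  · exact fun i j h => Fin.ext (by simpa using h)
  · intro v
    simp only [decide_eq_true_eq, Set.mem_range]
    refine ⟨fun h => ⟨⟨v - k, by omega⟩, Fin.ext (by dsimp only; omega)⟩, fun ⟨i, hi⟩ => ?_⟩
    rw [← hi]
    dsimp only
    omega
  · intro i
    dsimp only
    omega

theorem Knuth.headPart {n : ℕ} {α α' : Wr B n} (h : Knuth (word α) (word α')) (k : Fin (n + 1)) :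
    FQ.headPart α k = FQ.headPart α' k ∨
      Knuth (word (FQ.headPart α k)) (word (FQ.headPart α' k)) := by
  rw [← word_injective.eq_iff, word_headPart, word_headPart]
  exact h.filter (p := fun v => decide (v ≤ (k : ℕ))) fun a b c _ hbc _ hc =>
    decide_eq_true (hbc.trans (of_decide_eq_true hc))

theorem Knuth.tailPart {n : ℕ} {α α' : Wr B n} (h : Knuth (word α) (word α')) (k : Fin (n + 1)) :
    FQ.tailPart α k = FQ.tailPart α' k ∨
      Knuth (word (FQ.tailPart α k)) (word (FQ.tailPart α' k)) := by
  rw [← word_injective.eq_iff, word_tailPart, word_tailPart]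
  refine (h.filter (p := fun v => decide ((k : ℕ) < v)) fun a b c hab _ ha _ =>
    decide_eq_true ((of_decide_eq_true ha).trans_le hab)).imp (fun heq => by rw [heq])
    fun hfilter => hfilter.map fun x hx y _ hxy => ?_
  have := of_decide_eq_true (List.mem_filter.1 hx).2
  omega

theorem sigma_subPart_eq {n k k' : ℕ} (α : Wr B n) {e : Fin k → Fin n} {e' : Fin k' → Fin n}
    (h : k = k') (he : ∀ i, e i = e' (Fin.cast h i)) :
    (⟨k, subPart α e⟩ : Σ n, Wr B n) = ⟨k', subPart α e'⟩ := by
  subst h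
  rw [funext he]
  rfl

theorem eq_dual_subPart_iff {inv : B → B} {n k : ℕ} {γ : Wr B n} {e : Fin k → Fin n}
    (he : Function.Injective e) {α : Wr B k} :
    α = dual inv (subPart γ e) ↔ (StrictMono fun i => γ.2⁻¹ (e (α.2⁻¹ i))) ∧
      ∀ i, α.1 i = inv (γ.1 (e (α.2⁻¹ i))) := by
  constructor
  · rintro rfl
    refine ⟨?_, fun i => by simp [subPart]⟩
    simp only [dual_snd, inv_inv]
    exact strictMono_comp_sort (γ.2⁻¹.injective.comp he)
  · rintro ⟨hmono, hcolour⟩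
    have hsort : Tuple.sort (fun i => γ.2⁻¹ (e i)) = α.2⁻¹ := sort_eq_of_strictMono hmono
    refine Prod.ext (funext fun i => ?_) ?_
    · rw [dual_fst, hcolour]
      simp only [subPart, hsort]
    · rw [dual_snd]
      simp only [subPart, hsort, inv_inv]

theorem leftAct_concat_eq_dual_iff {inv : B → B} {n m : ℕ} {α : Wr B n} {β : Wr B m}
    {γ : Wr B (n + m)} {ρ : Equiv.Perm (Fin (n + m))} :
    leftAct ρ (concat α β) = dual inv γ ↔ ρ * permProd α.2 β.2 = γ.2⁻¹ ∧
      (∀ i, α.1 i = inv (γ.1 (Fin.castAdd m (α.2⁻¹ i)))) ∧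
        ∀ i, β.1 i = inv (γ.1 (Fin.natAdd n (β.2⁻¹ i))) := by
  rw [Prod.ext_iff, and_comm, dual_snd]
  refine and_congr_right fun hperm : ρ * permProd α.2 β.2 = γ.2⁻¹ => ?_
  have hleft (y : Fin (n + m)) : (leftAct ρ (concat α β)).1 (γ.2⁻¹ y) =
      Fin.append α.1 β.1 (permProd α.2 β.2 y) := by
    simp [← hperm, leftAct, concat]
  have hright (y : Fin (n + m)) : (dual inv γ).1 (γ.2⁻¹ y) = inv (γ.1 y) := by simp
  rw [funext_iff, (γ.2⁻¹).surjective.forall]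
  simp only [hleft, hright]
  constructor
  · exact fun h => ⟨fun i => by simpa using h (Fin.castAdd m (α.2⁻¹ i)),
      fun i => by simpa using h (Fin.natAdd n (β.2⁻¹ i))⟩
  · rintro ⟨hα, hβ⟩ y
    refine Fin.addCases (fun i => ?_) (fun i => ?_) y
    · simpa using hα (α.2 i)
    · simpa using hβ (β.2 i)

theorem mem_shuffles_and_leftAct_concat_eq_dual_iff {inv : B → B} {n m : ℕ} {α : Wr B n}
    {β : Wr B m} {γ : Wr B (n + m)} {ρ : Equiv.Perm (Fin (n + m))} :
    ρ ∈ shuffles n m ∧ leftAct ρ (concat α β) = dual inv γ ↔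
      ρ = γ.2⁻¹ * (permProd α.2 β.2)⁻¹ ∧ α = dual inv (subPart γ (Fin.castAdd m)) ∧
        β = dual inv (subPart γ (Fin.natAdd n)) := by
  have hmono (hρ : ρ * permProd α.2 β.2 = γ.2⁻¹) : ρ ∈ shuffles n m ↔
      (StrictMono fun i => γ.2⁻¹ (Fin.castAdd m (α.2⁻¹ i))) ∧
        StrictMono fun i => γ.2⁻¹ (Fin.natAdd n (β.2⁻¹ i)) := by
    simp [mem_shuffles_iff, ← hρ]
  rw [eq_dual_subPart_iff (Fin.castAdd_injective n m), eq_dual_subPart_iff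
    (Fin.natAdd_injective m n), leftAct_concat_eq_dual_iff, eq_mul_inv_iff_mul_eq]
  tauto

end Words

/-! ### The submodule spanned by the coplactic classes and its polar -/

section StandardRows

variable {B : Type*}

/-- The dual of a basis element of `𝓕(KB)`, in any degree. -/
def sigmaDual (inv : B → B) (s : Σ n, Wr B n) : Σ n, Wr B n := ⟨s.1, dual inv s.2⟩

theorem sigmaDual_involutive {inv : B → B} (hinv : Function.Involutive inv) :
    Function.Involutive (sigmaDual inv) :=
  fun s => Sigma.ext rfl (heq_of_eq (dual_dual hinv s.2))

variable [Fintype B]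

/-- The set of the standard `B`-tableaux, given by their numbers of boxes and their rows. -/
abbrev StandardRows (B : Type*) [Fintype B] : Type _ :=
  {k : ℕ × (B → List (List ℕ)) // IsStandardRows k.1 k.2}

/-- The number of boxes and the shape, as a family of lists of row lengths, of a standard
`B`-tableau. -/
def shapeKey (k : StandardRows B) : ℕ × (B → List ℕ) :=
  (k.1.1, fun b => (k.1.2 b).map List.length)

/-- The permutation of the components of a standard `B`-tableau by an involution of `B`. -/
def StandardRows.comp {inv : B → B} (hinv : Function.Involutive inv) (k : StandardRows B) :
    StandardRows B :=
  ⟨(k.1.1, fun b => k.1.2 (inv b)), fun b => k.2.1 (inv b),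
    (Equiv.sum_comp hinv.toPerm fun b => ((k.1.2 b).flatten : Multiset ℕ)).trans k.2.2⟩

theorem StandardRows.comp_involutive {inv : B → B} (hinv : Function.Involutive inv) :
    Function.Involutive (StandardRows.comp hinv) :=
  fun k => Subtype.ext (Prod.ext rfl (funext fun b => congrArg k.1.2 (hinv b)))

variable [DecidableEq B]

/-- The record tableau of a basis element of `𝓕(KB)`. -/
def recordKey (s : Σ n, Wr B n) : StandardRows B :=
  ⟨(s.1, recordRows s.2), isStandardRows_recordRows s.2⟩

/-- The insertion tableau of a basis element of `𝓕(KB)`. -/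
def insertionKey (s : Σ n, Wr B n) : StandardRows B :=
  ⟨(s.1, insertionRows s.2), isStandardRows_insertionRows s.2⟩

theorem insertionKey_eq_iff {n : ℕ} {α β : Wr B n} :
    insertionKey ⟨n, α⟩ = insertionKey ⟨n, β⟩ ↔ insertionRows α = insertionRows β := by
  simp [insertionKey]

theorem fst_eq_of_insertionKey_eq {s s' : Σ n, Wr B n} (h : insertionKey s = insertionKey s') :
    s.1 = s'.1 := congrArg (fun k => k.1.1) h

theorem fst_eq_of_recordKey_eq {s s' : Σ n, Wr B n} (h : recordKey s = recordKey s') :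
    s.1 = s'.1 := congrArg (fun k => k.1.1) h

theorem finite_recordKey_fiber (k : StandardRows B) :
    ((recordKey : (Σ n, Wr B n) → StandardRows B) ⁻¹' {k}).Finite := by
  refine (Set.finite_range (Sigma.mk (β := fun n => Wr B n) k.1.1)).subset ?_
  rintro ⟨n, α⟩ rfl
  exact ⟨α, rfl⟩

theorem isPairing_keys :
    IsPairing (recordKey : (Σ n, Wr B n) → StandardRows B) insertionKey shapeKey where
  eq s := Prod.ext rfl (funext fun b => map_length_insertionRows s.2 b)
  exists_eq := by
    rintro ⟨⟨n, R⟩, hR⟩ ⟨⟨n', R'⟩, hR'⟩ h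
    obtain ⟨rfl, hshape⟩ := Prod.mk.inj h
    obtain ⟨α, hα, hα'⟩ := exists_of_isStandardRows hR hR' (congrFun hshape)
    exact ⟨⟨n, α⟩, Subtype.ext (Prod.ext rfl hα), Subtype.ext (Prod.ext rfl hα')⟩
  unique := by
    rintro ⟨n, α⟩ ⟨n', β⟩ h h'
    obtain rfl : n = n' := fst_eq_of_recordKey_eq h'
    rw [eq_of_rows_eq (insertionKey_eq_iff.1 h) (by simpa [recordKey] using h')]

theorem recordKey_sigmaDual {inv : B → B} (hinv : Function.Involutive inv) (s : Σ n, Wr B n) :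
    recordKey (sigmaDual inv s) = (insertionKey s).comp hinv :=
  Subtype.ext (Prod.ext rfl (funext fun b => recordRows_dual hinv s.2 b))

theorem insertionKey_sigmaDual {inv : B → B} (hinv : Function.Involutive inv) (s : Σ n, Wr B n) :
    insertionKey (sigmaDual inv s) = (recordKey s).comp hinv := by
  rw [← StandardRows.comp_involutive hinv (insertionKey _), ← recordKey_sigmaDual,
    sigmaDual_involutive hinv]

end StandardRows

section Polar

variable {K : Type*} [CommRing K] {B : Type*}

theorem pairing_single (inv : B → B) (s : Σ n, Wr B n) (a : K) (x : Free K B) :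
    pairing K inv (Finsupp.single s a) x = a * x (sigmaDual inv s) := by
  simp [pairing, sigmaDual]

theorem pairing_comm {inv : B → B} (hinv : Function.Involutive inv) (x y : Free K B) :
    pairing K inv x y = pairing K inv y x := by
  classical
  suffices h : pairing K inv = (pairing K inv).flip from LinearMap.congr_fun₂ h x y
  ext s s'
  have hdual : s' = sigmaDual inv s ↔ s = sigmaDual inv s' := by
    rw [eq_comm, (sigmaDual_involutive hinv).eq_iff]
  simp [pairing_single, Finsupp.single_apply, hdual]

theorem mem_polar_span {inv : B → B} {A : Set (Free K B)} {x : Free K B} :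
    x ∈ polar inv (Submodule.span K A) ↔ ∀ y ∈ A, pairing K inv x y = 0 := by
  refine ⟨fun hx y hy => hx y (Submodule.subset_span hy), fun hx y hy => ?_⟩
  exact Submodule.span_le (p := LinearMap.ker (pairing K inv x)).2 hx hy

variable [Fintype B] [DecidableEq B]

theorem coplacticClass_eq_fiberSum {T : BTableau B} (hT : T.IsStandard) :
    coplacticClass K T = fiberSum K finite_recordKey_fiber
      ⟨(T.size, fun b => (T b).rows), hT.isStandardRows⟩ := by
  classical
  ext ⟨n, α⟩
  rw [coplacticClass, Finsupp.finsetSum_apply, fiberSum_apply]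
  simp only [elt, Finsupp.single_apply]
  by_cases hn : T.size = n
  · subst hn
    simp only [Sigma.mk.injEq, heq_eq_eq, true_and, recordKey, Subtype.mk.injEq, Prod.mk.injEq,
      Finset.sum_ite_eq', Finset.mem_filter, Finset.mem_univ, funext_iff]
  · rw [Finset.sum_eq_zero, if_neg]
    · exact fun h => hn (congrArg (fun k => k.1.1) h).symm
    · exact fun α _ => if_neg fun h => hn (congrArg Sigma.fst h)

theorem coplactic_eq_span_fiberSum : coplactic K B =
    Submodule.span K (Set.range (fiberSum K (finite_recordKey_fiber (B := B)))) := by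
  rw [coplactic]
  congr 1
  ext x
  constructor
  · rintro ⟨T, hT, rfl⟩
    exact ⟨_, (coplacticClass_eq_fiberSum hT).symm⟩
  · rintro ⟨⟨⟨n, R⟩, hR⟩, rfl⟩
    obtain ⟨T, hT, rfl, rfl⟩ := hR.exists_isStandard
    exact ⟨T, hT, (coplacticClass_eq_fiberSum hT).symm⟩

theorem coplactic_eq_range_fiberSums :
    coplactic K B = LinearMap.range (fiberSums K (finite_recordKey_fiber (B := B))) := by
  rw [range_fiberSums, coplactic_eq_span_fiberSum]

theorem mem_coplactic_iff {x : Free K B} :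
    x ∈ coplactic K B ↔ ∀ s s', recordKey s = recordKey s' → x s = x s' := by
  rw [coplactic_eq_range_fiberSums, mem_range_fiberSums _ isPairing_keys.surjective_left]

theorem pairing_fiberSum {inv : B → B} (hinv : Function.Involutive inv) (x : Free K B)
    (k : StandardRows B) : pairing K inv x (fiberSum K finite_recordKey_fiber k) =
      x.mapDomain insertionKey (k.comp hinv) := by
  classical
  suffices h : (pairing K inv).flip (fiberSum K finite_recordKey_fiber k) =
      Finsupp.lapply (k.comp hinv) ∘ₗ Finsupp.lmapDomain K K insertionKey from
    LinearMap.congr_fun h x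
  ext s
  simp [pairing_single, fiberSum_apply, recordKey_sigmaDual hinv, Finsupp.single_apply,
    (StandardRows.comp_involutive hinv).eq_iff]

theorem polar_coplactic {inv : B → B} (hinv : Function.Involutive inv) :
    polar inv (coplactic K B) =
      LinearMap.ker (Finsupp.lmapDomain K K (insertionKey : (Σ n, Wr B n) → StandardRows B)) := by
  ext x
  rw [coplactic_eq_span_fiberSum, mem_polar_span, Set.forall_mem_range, LinearMap.mem_ker,
    Finsupp.lmapDomain_apply, Finsupp.ext_iff]
  simp only [pairing_fiberSum hinv]
  exact ((StandardRows.comp_involutive hinv).surjective.forall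
    (p := fun k => x.mapDomain insertionKey k = 0)).symm

end Polar

/-! ### The subbialgebra and the biideal -/

section Adjunction

variable {K : Type*} [CommRing K] {B : Type*}

theorem extMul_elt {n m : ℕ} (α : Wr B n) (β : Wr B m) :
    extMul K B (elt K α) (elt K β) = ∑ ρ ∈ shuffles n m, elt K (leftAct ρ (concat α β)) := by
  simp [extMul, elt]

theorem comul_elt {n : ℕ} (α : Wr B n) :
    comul K B (elt K α) =
      ∑ k : Fin (n + 1), elt K (headPart α k) ⊗ₜ[K] elt K (tailPart α k) := by
  simp [comul, elt]

theorem pairing_elt_elt (inv : B → B) {n : ℕ} (α β : Wr B n) [Decidable (β = dual inv α)] :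
    pairing K inv (elt K α) (elt K β) = if β = dual inv α then 1 else 0 := by
  classical
  rw [elt, pairing_single, one_mul, elt, Finsupp.single_apply]
  exact if_congr (by simp [sigmaDual]) rfl rfl

theorem pairing_elt_elt_of_ne (inv : B → B) {n m : ℕ} (h : n ≠ m) (α : Wr B n) (β : Wr B m) :
    pairing K inv (elt K α) (elt K β) = 0 := by
  rw [elt, pairing_single, one_mul, elt, Finsupp.single_eq_of_ne]
  exact fun heq => h (congrArg Sigma.fst heq)

/-- The pairing on `𝓕(KB) ⊗ 𝓕(KB)` induced by the pairing on `𝓕(KB)`. -/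
noncomputable def tensorPairing (K : Type*) [CommRing K] (inv : B → B) :
    Free K B ⊗[K] Free K B →ₗ[K] Free K B ⊗[K] Free K B →ₗ[K] K :=
  LinearMap.BilinForm.tmul (pairing K inv) (pairing K inv)

@[simp] theorem tensorPairing_tmul_tmul (inv : B → B) (x y z w : Free K B) :
    tensorPairing K inv (x ⊗ₜ y) (z ⊗ₜ w) = pairing K inv x z * pairing K inv y w :=
  mul_comm _ _

theorem elt_headPart {n m : ℕ} (γ : Wr B (n + m)) {k : Fin (n + m + 1)} (hk : (k : ℕ) = n) :
    elt K (headPart γ k) = elt K (subPart γ (Fin.castAdd m)) := by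
  rw [headPart_eq]
  exact congrArg (Finsupp.single · 1) (sigma_subPart_eq γ hk fun i => Fin.ext (by simp))

theorem elt_tailPart {n m : ℕ} (γ : Wr B (n + m)) {k : Fin (n + m + 1)} (hk : (k : ℕ) = n) :
    elt K (tailPart γ k) = elt K (subPart γ (Fin.natAdd n)) := by
  rw [tailPart_eq]
  exact congrArg (Finsupp.single · 1)
    (sigma_subPart_eq γ (by omega) fun i => Fin.ext (by simp [hk]))

theorem pairing_elt_extMul (inv : B → B) {n m : ℕ} (γ : Wr B (n + m)) (α : Wr B n) (β : Wr B m) :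
    pairing K inv (elt K γ) (extMul K B (elt K α) (elt K β)) =
      pairing K inv (elt K (subPart γ (Fin.castAdd m))) (elt K α) *
        pairing K inv (elt K (subPart γ (Fin.natAdd n))) (elt K β) := by
  classical
  rw [extMul_elt, map_sum]
  simp only [pairing_elt_elt, ite_zero_mul_ite_zero, mul_one]
  have hfilter : (shuffles n m).filter (fun ρ => leftAct ρ (concat α β) = dual inv γ) =
      if α = dual inv (subPart γ (Fin.castAdd m)) ∧ β = dual inv (subPart γ (Fin.natAdd n))
        then {γ.2⁻¹ * (permProd α.2 β.2)⁻¹} else ∅ := by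
    ext ρ
    rw [Finset.mem_filter, mem_shuffles_and_leftAct_concat_eq_dual_iff]
    split_ifs with h <;> simp [h]
  rw [← Finset.sum_filter, hfilter]
  split_ifs <;> simp

theorem pairing_elt_extMul_of_ne (inv : B → B) {N n m : ℕ} (hN : N ≠ n + m) (γ : Wr B N)
    (α : Wr B n) (β : Wr B m) :
    pairing K inv (elt K γ) (extMul K B (elt K α) (elt K β)) = 0 := by
  rw [extMul_elt, map_sum]
  exact Finset.sum_eq_zero fun ρ _ => pairing_elt_elt_of_ne inv hN _ _

theorem tensorPairing_comul_elt (inv : B → B) {n m : ℕ} (γ : Wr B (n + m)) (α : Wr B n)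
    (β : Wr B m) :
    tensorPairing K inv (comul K B (elt K γ)) (elt K α ⊗ₜ elt K β) =
      pairing K inv (elt K (subPart γ (Fin.castAdd m))) (elt K α) *
        pairing K inv (elt K (subPart γ (Fin.natAdd n))) (elt K β) := by
  rw [comul_elt, map_sum, LinearMap.sum_apply]
  simp only [tensorPairing_tmul_tmul]
  have hn : n < n + m + 1 := by omega
  rw [Finset.sum_eq_single (⟨n, hn⟩ : Fin (n + m + 1)) (fun k _ hk => ?_) (by simp)]
  · rw [elt_headPart γ rfl, elt_tailPart γ rfl]
  · rw [pairing_elt_elt_of_ne inv (fun h => hk (Fin.ext h)), zero_mul]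

theorem tensorPairing_comul_elt_of_ne (inv : B → B) {N n m : ℕ} (hN : N ≠ n + m) (γ : Wr B N)
    (α : Wr B n) (β : Wr B m) :
    tensorPairing K inv (comul K B (elt K γ)) (elt K α ⊗ₜ elt K β) = 0 := by
  rw [comul_elt, map_sum, LinearMap.sum_apply]
  refine Finset.sum_eq_zero fun k _ => ?_
  rw [tensorPairing_tmul_tmul]
  by_cases hk : (k : ℕ) = n
  · rw [pairing_elt_elt_of_ne inv (n := N - k) (by omega), mul_zero]
  · rw [pairing_elt_elt_of_ne inv hk, zero_mul]

theorem pairing_extMul (inv : B → B) (x y z : Free K B) :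
    pairing K inv z (extMul K B x y) = tensorPairing K inv (comul K B z) (x ⊗ₜ y) := by
  suffices h : (extMul K B).compr₂ (pairing K inv).flip =
      (TensorProduct.mk K (Free K B) (Free K B)).compr₂ ((tensorPairing K inv ∘ₗ comul K B).flip)
    from LinearMap.congr_fun (LinearMap.congr_fun₂ h x y) z
  ext ⟨n, α⟩ ⟨m, β⟩ ⟨N, γ⟩
  change pairing K inv (elt K γ) (extMul K B (elt K α) (elt K β)) =
    tensorPairing K inv (comul K B (elt K γ)) (elt K α ⊗ₜ elt K β)
  by_cases hN : N = n + m
  · subst hN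
    rw [pairing_elt_extMul, tensorPairing_comul_elt]
  · rw [pairing_elt_extMul_of_ne inv hN, tensorPairing_comul_elt_of_ne inv hN]

theorem pairing_one (inv : B → B) (x : Free K B) : pairing K inv x (one K B) = counit K B x := by
  suffices h : (pairing K inv).flip (one K B) = counit K B from LinearMap.congr_fun h x
  ext ⟨n, α⟩
  change pairing K inv (elt K α) (elt K _) = elt K α ⟨0, _⟩
  rcases n with _ | n
  · classical
    rw [pairing_elt_elt, if_pos (Subsingleton.elim _ _), Subsingleton.elim α (Fin.elim0, 1), elt,
      Finsupp.single_eq_same]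
  · rw [pairing_elt_elt_of_ne inv n.succ_ne_zero, elt, Finsupp.single_eq_of_ne (by simp)]

theorem tensorPairing_single_tmul_single {inv : B → B} (hinv : Function.Involutive inv)
    (z : Free K B ⊗[K] Free K B) (s t : Σ n, Wr B n) :
    tensorPairing K inv z
        (Finsupp.single (sigmaDual inv s) 1 ⊗ₜ Finsupp.single (sigmaDual inv t) 1) =
      finsuppTensorFinsupp' K _ _ z (s, t) := by
  induction z using TensorProduct.induction_on with
  | zero => simp
  | tmul x y =>
    rw [tensorPairing_tmul_tmul, pairing_comm hinv, pairing_single, pairing_comm hinv,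
      pairing_single, sigmaDual_involutive hinv, sigmaDual_involutive hinv,
      finsuppTensorFinsupp'_apply_apply, one_mul, one_mul]
  | add x y hx hy => rw [map_add, map_add, LinearMap.add_apply, Finsupp.add_apply, hx, hy]

end Adjunction

section Bialgebra

variable {K : Type*} [CommRing K] {B : Type*}

theorem elt_mem_degreePart {n : ℕ} (α : Wr B n) : elt K α ∈ degreePart K B n :=
  Finsupp.single_mem_supported K 1 rfl

/-- The differences `α - α'` of elements of `B ≀ 𝔖ₙ` that are related by a Knuth relation. -/
def knuthDifferences (K : Type*) [CommRing K] (B : Type*) (n : ℕ) : Set (Free K B) :=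
  {x | ∃ α α' : Wr B n, Knuth (word α) (word α') ∧ x = elt K α - elt K α'}

theorem knuthDifferences_subset_degreePart (n : ℕ) :
    knuthDifferences K B n ⊆ degreePart K B n := by
  rintro _ ⟨α, α', -, rfl⟩
  exact sub_mem (elt_mem_degreePart α) (elt_mem_degreePart α')

theorem elt_sub_elt_mem_span_knuthDifferences {n : ℕ} {α β : Wr B n}
    (h : KnuthEquiv (word α) (word β)) :
    elt K α - elt K β ∈ Submodule.span K (knuthDifferences K B n) := by
  suffices hword : ∀ w, KnuthEquiv (word α) w → ∃ γ : Wr B n, word γ = w ∧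
      elt K α - elt K γ ∈ Submodule.span K (knuthDifferences K B n) by
    obtain ⟨γ, hγ, hmem⟩ := hword _ h
    rwa [← word_injective hγ]
  intro w hw
  induction hw with
  | refl => exact ⟨α, rfl, by rw [sub_self]; exact zero_mem _⟩
  | tail _ hstep ih =>
    obtain ⟨γ, rfl, hγ⟩ := ih
    obtain ⟨δ, rfl⟩ := exists_word_eq
      ((Multiset.coe_eq_coe.2 (hstep.perm.map Prod.fst)).symm.trans (map_fst_word γ))
    refine ⟨δ, rfl, ?_⟩
    rw [← sub_add_sub_cancel _ (elt K γ)]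
    exact add_mem hγ (Submodule.subset_span ⟨γ, δ, hstep, rfl⟩)

variable [Fintype B] [DecidableEq B] {inv : B → B} (hinv : Function.Involutive inv)

include hinv

theorem single_sub_single_mem_polar {s s' : Σ n, Wr B n} (h : insertionKey s = insertionKey s') :
    Finsupp.single s (1 : K) - Finsupp.single s' 1 ∈ polar inv (coplactic K B) := by
  rw [polar_coplactic hinv]
  exact single_sub_single_mem_ker _ h

theorem elt_sub_elt_mem_polar {n : ℕ} {α β : Wr B n} (h : Knuth (word α) (word β)) :
    elt K α - elt K β ∈ polar inv (coplactic K B) :=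
  single_sub_single_mem_polar hinv (insertionKey_eq_iff.2 h.insertionRows_eq)

theorem mem_of_mem_polar {x : Free K B} (hx : x ∈ polar inv (coplactic K B))
    {S : Submodule K (Free K B)} (hS : ∀ s ∈ x.support, knuthDifferences K B s.1 ⊆ S) : x ∈ S := by
  rw [polar_coplactic hinv, LinearMap.mem_ker, Finsupp.lmapDomain_apply] at hx
  refine Submodule.span_le.2 ?_ (mem_span_of_mapDomain_eq_zero _ hx)
  rintro _ ⟨⟨n, α⟩, hs, ⟨n', β⟩, h, rfl⟩
  obtain rfl : n = n' := fst_eq_of_insertionKey_eq h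
  exact Submodule.span_le.2 (hS _ hs)
    (elt_sub_elt_mem_span_knuthDifferences (knuthEquiv_word (insertionKey_eq_iff.1 h)))

theorem polar_inf_degreePart (n : ℕ) :
    polar inv (coplactic K B) ⊓ degreePart K B n =
      Submodule.span K (knuthDifferences K B n) := by
  apply le_antisymm
  · rintro x ⟨hx, hdegree⟩
    refine mem_of_mem_polar hinv hx fun s hs => ?_
    obtain rfl : s.1 = n := (Finsupp.mem_supported K x).1 hdegree hs
    exact Submodule.subset_span
  · refine Submodule.span_le.2 fun x hx => ⟨?_, knuthDifferences_subset_degreePart n hx⟩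
    obtain ⟨α, α', h, rfl⟩ := hx
    exact elt_sub_elt_mem_polar hinv h

theorem polar_le_of_knuth {S : Submodule K (Free K B)} (h : ∀ {n : ℕ} {α α' : Wr B n},
    Knuth (word α) (word α') → elt K α - elt K α' ∈ S) : polar inv (coplactic K B) ≤ S := by
  refine fun x hx => mem_of_mem_polar hinv hx fun s _ => ?_
  rintro _ ⟨α, α', hα, rfl⟩
  exact h hα

theorem isGraded_polar : IsGraded (polar inv (coplactic K B)) := by
  refine le_antisymm (polar_le_of_knuth hinv fun {n _ _} h => ?_) (iSup_le fun n => inf_le_left)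
  exact Submodule.mem_iSup_of_mem n
    ⟨elt_sub_elt_mem_polar hinv h, knuthDifferences_subset_degreePart n ⟨_, _, h, rfl⟩⟩

theorem extMul_mem_polar_left (x : Free K B) {y : Free K B} (hy : y ∈ polar inv (coplactic K B)) :
    extMul K B x y ∈ polar inv (coplactic K B) := by
  induction x using Finsupp.induction_linear with
  | zero => simp
  | add x x' hx hx' => rw [map_add, LinearMap.add_apply]; exact add_mem hx hx'
  | single s a =>
    rw [← Finsupp.smul_single_one, map_smul, LinearMap.smul_apply]
    refine Submodule.smul_mem _ a (polar_le_of_knuth hinv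
      (S := (polar inv (coplactic K B)).comap (extMul K B (elt K s.2))) (fun h => ?_) hy)
    rw [Submodule.mem_comap, map_sub, extMul_elt, extMul_elt, ← Finset.sum_sub_distrib]
    exact sum_mem fun ρ hρ => elt_sub_elt_mem_polar hinv (h.leftAct_concat_right hρ s.2)

theorem extMul_mem_polar_right {x : Free K B} (hx : x ∈ polar inv (coplactic K B)) (y : Free K B) :
    extMul K B x y ∈ polar inv (coplactic K B) := by
  induction y using Finsupp.induction_linear with
  | zero => simp
  | add y y' hy hy' => rw [map_add]; exact add_mem hy hy'
  | single s a =>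
    rw [← Finsupp.smul_single_one, map_smul]
    refine Submodule.smul_mem _ a (polar_le_of_knuth hinv
      (S := (polar inv (coplactic K B)).comap ((extMul K B).flip (elt K s.2))) (fun h => ?_) hx)
    rw [Submodule.mem_comap, map_sub, LinearMap.flip_apply, LinearMap.flip_apply, extMul_elt,
      extMul_elt, ← Finset.sum_sub_distrib]
    exact sum_mem fun ρ hρ => elt_sub_elt_mem_polar hinv (h.leftAct_concat_left hρ s.2)

theorem elt_headPart_sub_mem_polar {n : ℕ} {α α' : Wr B n} (h : Knuth (word α) (word α'))
    (k : Fin (n + 1)) :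
    elt K (headPart α k) - elt K (headPart α' k) ∈ polar inv (coplactic K B) := by
  rcases h.headPart k with heq | hknuth
  · rw [heq, sub_self]
    exact zero_mem _
  · exact elt_sub_elt_mem_polar hinv hknuth

theorem elt_tailPart_sub_mem_polar {n : ℕ} {α α' : Wr B n} (h : Knuth (word α) (word α'))
    (k : Fin (n + 1)) :
    elt K (tailPart α k) - elt K (tailPart α' k) ∈ polar inv (coplactic K B) := by
  rcases h.tailPart k with heq | hknuth
  · rw [heq, sub_self]
    exact zero_mem _
  · exact elt_sub_elt_mem_polar hinv hknuth

theorem comul_mem_of_mem_polar {x : Free K B} (hx : x ∈ polar inv (coplactic K B)) :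
    comul K B x ∈
      LinearMap.range (TensorProduct.map (polar inv (coplactic K B)).subtype LinearMap.id) ⊔
      LinearMap.range (TensorProduct.map LinearMap.id (polar inv (coplactic K B)).subtype) := by
  refine polar_le_of_knuth hinv (S := Submodule.comap (comul K B) (_ ⊔ _)) (fun {n α α'} h => ?_) hx
  have hcomul : comul K B (elt K α) - comul K B (elt K α') = ∑ k : Fin (n + 1),
      ((elt K (headPart α k) - elt K (headPart α' k)) ⊗ₜ[K] elt K (tailPart α k) +
        elt K (headPart α' k) ⊗ₜ[K] (elt K (tailPart α k) - elt K (tailPart α' k))) := by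
    simp only [comul_elt, TensorProduct.sub_tmul, TensorProduct.tmul_sub, sub_add_sub_cancel]
    exact (Finset.sum_sub_distrib (G := Free K B ⊗[K] Free K B) _ _).symm
  rw [Submodule.mem_comap, map_sub, hcomul]
  refine sum_mem fun k _ => ?_
  exact Submodule.add_mem_sup
    ⟨⟨_, elt_headPart_sub_mem_polar hinv h k⟩ ⊗ₜ _, TensorProduct.map_tmul _ _ _ _⟩
    ⟨_ ⊗ₜ ⟨_, elt_tailPart_sub_mem_polar hinv h k⟩, TensorProduct.map_tmul _ _ _ _⟩

theorem counit_eq_zero_of_mem_polar {x : Free K B} (hx : x ∈ polar inv (coplactic K B)) :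
    counit K B x = 0 := by
  refine polar_le_of_knuth hinv (S := LinearMap.ker (counit K B)) (fun {n α α'} _ => ?_) hx
  rw [LinearMap.mem_ker, map_sub]
  cases n with
  | zero => rw [Subsingleton.elim α α', sub_self]
  | succ n => simp [counit, elt]

theorem isGradedBiideal_polar : IsGradedBiideal (polar inv (coplactic K B)) where
  graded := isGraded_polar hinv
  mul_mem_left x _ hy := extMul_mem_polar_left hinv x hy
  mul_mem_right _ hx y := extMul_mem_polar_right hinv hx y
  comul_mem _ hx := comul_mem_of_mem_polar hinv hx
  counit_eq_zero _ hx := counit_eq_zero_of_mem_polar hinv hx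

theorem single_sigmaDual_sub_mem_polar {s s' : Σ n, Wr B n} (h : recordKey s = recordKey s') :
    Finsupp.single (sigmaDual inv s) (1 : K) - Finsupp.single (sigmaDual inv s') 1 ∈
      polar inv (coplactic K B) :=
  single_sub_single_mem_polar hinv (by rw [insertionKey_sigmaDual hinv, insertionKey_sigmaDual, h])

theorem polar_polar_coplactic :
    polar inv (polar inv (coplactic K B)) = coplactic K B := by
  refine le_antisymm (fun x hx => mem_coplactic_iff.2 fun s s' h => ?_) fun x hx y hy => ?_
  · have hzero := hx _ (single_sigmaDual_sub_mem_polar hinv h)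
    rwa [pairing_comm hinv, map_sub, LinearMap.sub_apply, pairing_single, pairing_single,
      sigmaDual_involutive hinv, sigmaDual_involutive hinv, one_mul, one_mul, sub_eq_zero] at hzero
  · rw [pairing_comm hinv]
    exact hy x hx

theorem mem_coplactic_of_pairing {x : Free K B}
    (h : ∀ z ∈ polar inv (coplactic K B), pairing K inv z x = 0) : x ∈ coplactic K B := by
  rw [← polar_polar_coplactic hinv]
  exact fun z hz => (pairing_comm hinv x z).trans (h z hz)

omit hinv in
theorem tensorPairing_tmul_eq_zero {z : Free K B ⊗[K] Free K B}
    (hz : z ∈ LinearMap.range (TensorProduct.map (polar inv (coplactic K B)).subtype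
        LinearMap.id) ⊔
      LinearMap.range (TensorProduct.map LinearMap.id (polar inv (coplactic K B)).subtype))
    {x y : Free K B} (hx : x ∈ coplactic K B) (hy : y ∈ coplactic K B) :
    tensorPairing K inv z (x ⊗ₜ y) = 0 := by
  rw [TensorProduct.range_map, TensorProduct.range_map, Submodule.range_subtype] at hz
  refine (sup_le (Submodule.map₂_le.2 fun u hu v _ => ?_) (Submodule.map₂_le.2 fun u _ v hv => ?_) :
    _ ≤ LinearMap.ker ((tensorPairing K inv).flip (x ⊗ₜ y))) hz
  · change tensorPairing K inv (u ⊗ₜ v) (x ⊗ₜ y) = 0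
    rw [tensorPairing_tmul_tmul, hu x hx, zero_mul]
  · change tensorPairing K inv (u ⊗ₜ v) (x ⊗ₜ y) = 0
    rw [tensorPairing_tmul_tmul, hv y hy, mul_zero]

omit hinv in
theorem isGraded_coplactic : IsGraded (coplactic K B) := by
  refine le_antisymm (Submodule.span_le.2 ?_) (iSup_le fun n => inf_le_left)
  rintro _ ⟨T, hT, rfl⟩
  exact Submodule.mem_iSup_of_mem T.size
    ⟨Submodule.subset_span ⟨T, hT, rfl⟩, sum_mem fun α _ => elt_mem_degreePart α⟩

theorem one_mem_coplactic : one K B ∈ coplactic K B :=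
  mem_coplactic_of_pairing hinv fun z hz =>
    (pairing_one inv z).trans (counit_eq_zero_of_mem_polar hinv hz)

theorem extMul_mem_coplactic {x y : Free K B} (hx : x ∈ coplactic K B) (hy : y ∈ coplactic K B) :
    extMul K B x y ∈ coplactic K B :=
  mem_coplactic_of_pairing hinv fun z hz => (pairing_extMul inv x y z).trans
    (tensorPairing_tmul_eq_zero (comul_mem_of_mem_polar hinv hz) hx hy)

theorem comul_mem_of_mem_coplactic {x : Free K B} (hx : x ∈ coplactic K B) :
    comul K B x ∈ LinearMap.range
      (TensorProduct.map (coplactic K B).subtype (coplactic K B).subtype) := by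
  rw [coplactic_eq_range_fiberSums]
  refine mem_range_map_range_fiberSums _ isPairing_keys.surjective_left
    fun s s' t t' hs ht => ?_
  have hcoord (s t : Σ n, Wr B n) : finsuppTensorFinsupp' K _ _ (comul K B x) (s, t) =
      pairing K inv (extMul K B (Finsupp.single (sigmaDual inv s) 1)
        (Finsupp.single (sigmaDual inv t) 1)) x := by
    rw [← tensorPairing_single_tmul_single hinv, ← pairing_extMul, pairing_comm hinv]
  rw [hcoord, hcoord, ← sub_eq_zero, ← LinearMap.sub_apply, ← map_sub,
    ← sub_add_sub_cancel _ (extMul K B (Finsupp.single (sigmaDual inv s') 1)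
      (Finsupp.single (sigmaDual inv t) 1)), ← LinearMap.map_sub₂, ← map_sub]
  exact add_mem
    (extMul_mem_polar_right hinv (single_sigmaDual_sub_mem_polar hinv hs) _)
    (extMul_mem_polar_left hinv _ (single_sigmaDual_sub_mem_polar hinv ht)) x hx

theorem isGradedSubbialgebra_coplactic : IsGradedSubbialgebra (coplactic K B) where
  graded := isGraded_coplactic
  one_mem := one_mem_coplactic hinv
  mul_mem _ hx _ hy := extMul_mem_coplactic hinv hx hy
  comul_mem _ hx := comul_mem_of_mem_coplactic hinv hx

theorem coplactic_inf_polar :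
    coplactic K B ⊓ polar inv (coplactic K B) =
      Submodule.span K {x | ∃ T T' : BTableau B, T.IsStandard ∧ T'.IsStandard ∧
        T.shape = T'.shape ∧ x = coplacticClass K T - coplacticClass K T'} := by
  rw [polar_coplactic hinv, coplactic_eq_range_fiberSums, isPairing_keys.range_inf_ker]
  congr 1
  ext x
  constructor
  · rintro ⟨⟨⟨n, R⟩, hR⟩, ⟨⟨n', R'⟩, hR'⟩, hshape, rfl⟩
    obtain ⟨T, hT, rfl, rfl⟩ := hR.exists_isStandard
    obtain ⟨T', hT', rfl, rfl⟩ := hR'.exists_isStandard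
    refine ⟨T, T', hT, hT', BTableau.shape_eq_iff.2 (congrFun (Prod.mk.inj hshape).2), ?_⟩
    rw [coplacticClass_eq_fiberSum hT, coplacticClass_eq_fiberSum hT']
  · rintro ⟨T, T', hT, hT', hshape, rfl⟩
    refine ⟨_, _, ?_, by rw [coplacticClass_eq_fiberSum hT, coplacticClass_eq_fiberSum hT']⟩
    exact Prod.ext (by simp [shapeKey, BTableau.size, hshape])
      (funext (BTableau.shape_eq_iff.1 hshape))

theorem exists_isCompl_coplactic_sup_polar :
    ∃ C : Submodule K (Free K B), IsCompl (coplactic K B ⊔ polar inv (coplactic K B)) C := by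
  rw [polar_coplactic hinv, coplactic_eq_range_fiberSums]
  exact isPairing_keys.exists_isCompl _

end Bialgebra

end FQ

theorem mainTheorem12 {K : Type*} [CommRing K] {B : Type*} [Fintype B] [DecidableEq B]
    (inv : B → B) (hinv : Function.Involutive inv) :
    (∀ n : ℕ, FQ.polar inv (FQ.coplactic K B) ⊓ FQ.degreePart K B n =
      Submodule.span K {x | ∃ α α' : FQ.Wr B n, FQ.Knuth (FQ.word α) (FQ.word α') ∧
        x = FQ.elt K α - FQ.elt K α'}) ∧
    FQ.IsGradedSubbialgebra (FQ.coplactic K B) ∧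
    FQ.IsGradedBiideal (FQ.polar inv (FQ.coplactic K B)) ∧
    FQ.coplactic K B ⊓ FQ.polar inv (FQ.coplactic K B) =
      Submodule.span K {x | ∃ T T' : FQ.BTableau B, T.IsStandard ∧ T'.IsStandard ∧
        T.shape = T'.shape ∧ x = FQ.coplacticClass K T - FQ.coplacticClass K T'} ∧
    ∃ C : Submodule K (FQ.Free K B),
      IsCompl (FQ.coplactic K B ⊔ FQ.polar inv (FQ.coplactic K B)) C := by
  exact ⟨FQ.polar_inf_degreePart hinv, FQ.isGradedSubbialgebra_coplactic hinv,
    FQ.isGradedBiideal_polar hinv, FQ.coplactic_inf_polar hinv,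
    FQ.exists_isCompl_coplactic_sup_polar hinv⟩
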